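/- Let $n\ge 1$. For $k\in\mathbb Z$ let $\mathcal M_k$ be the set of closed cubes $2^{-k}(m+[0,1]^n)$, $m\in\mathbb Z^n$, and let $\mathcal M=\bigcup_{k\in\mathbb Z}\mathcal M_k$. For a nonempty closed set $F\subseteq\mathbb R^n$ let $\mathrm{CUBE}(F)$ be the set of all families $\mathcal F\subseteq\mathcal M$ such that $\bigcup\mathcal F=\mathbb R^n\setminus F$, distinct members of $\mathcal F$ have disjoint interiors, and $\tfrac12\operatorname{diam}(Q)<d(Q,F)<5\operatorname{diam}(Q)$ for every $Q\in\mathcal F$ (Euclidean metric). Fix a rational number $\varepsilon$ with $0<\varepsilon<\tfrac15$; for a cube $Q$ with center $c_Q$ let $Q^*$ be its image under $x\mapsto(1+\varepsilon)(x-c_Q)+c_Q$, and put $\mathcal F_x=\{Q\in\mathcal F\mid x\in Q^*\}$. Closed sets are represented by total information (a list of rational open balls whose union is the complement, paired with a list of exactly those rational open balls that meet the set), points of $\mathbb R^n$ by rapidly converging Cauchy sequences of rational points, subsets of $\mathcal M$ by their characteristic functions, and finite subsets of $\mathcal M$ by natural number codes. A multi-valued problem is computable if some Type-2 machine maps every name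 of every admissible instance to a name of a result. (a) $\mathrm{CUBE}(F)\neq\emptyset$ for every nonempty closed $F$, and the problem $F\mapsto\mathcal F\in\mathrm{CUBE}(F)$ is computable. (b) For every nonempty closed $F$, every $\mathcal F\in\mathrm{CUBE}(F)$ and every $x\notin F$ there is a finite set $\mathcal G_x$ with $\mathcal F_x\subseteq\mathcal G_x\subseteq\mathcal F$ and $|\mathcal G_x|\le\lceil197\sqrt n\rceil^n$, and the problem $(F,\mathcal F,x)\mapsto\mathcal G_x$ is computable. In particular, for the family $\mathcal F$ computed from a name of $F$ as in (a), such sets $\mathcal G_x$ are uniformly computable from names of $F$ and of $x\notin F$. -/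

import Mathlib

open scoped Topology

noncomputable section

namespace Whitney

/-! ### Type-2 machines -/

/-- A Type-2 machine with a one-way read-only input tape and a one-way write-only output tape.
The finite control together with the contents of the two-way work tape is coded by one natural
number, the configuration; it starts as `0`. A step is an effective function of the configuration
and of the symbol under the input head; it yields the new configuration, whether the input head
advances by one cell, and the symbol (if any) that is appended to the output tape. Between two
accesses to the input or output tape a machine can thus perform any terminating work tape
computation, and a computation that never terminates is an infinite run without output. -/
structure TypeTwoMachine where
  step : ℕ × ℕ → ℕ × Bool × Option ℕ
  computable_step : Computable step

/-- Snapshot of a run: configuration, position of the input head, output written so far. -/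
structure Snapshot where
  config : ℕ
  head : ℕ
  output : List ℕ

/-- The snapshot after `t` steps on the input `p`. -/
def TypeTwoMachine.run (M : TypeTwoMachine) (p : ℕ → ℕ) : ℕ → Snapshot
  | 0 => ⟨0, 0, []⟩
  | t + 1 =>
    let s := M.run p t
    let r := M.step (s.config, p s.head)
    ⟨r.1, if r.2.1 then s.head + 1 else s.head, s.output ++ r.2.2.toList⟩

/-- On input `p` the machine writes the infinite sequence `q` on its output tape. -/
def TypeTwoMachine.Writes (M : TypeTwoMachine) (p q : ℕ → ℕ) : Prop :=
  ∀ i, ∃ t, (M.run p t).output[i]? = some (q i)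

/-! ### Represented spaces and computable problems -/

/-- A representation of `X`: a surjective partial map from `ℕ → ℕ` to `X`, given by its graph. -/
structure Representation (X : Type) where
  IsName : (ℕ → ℕ) → X → Prop
  unique : ∀ {p x y}, IsName p x → IsName p y → x = y
  surj : ∀ x, ∃ p, IsName p x

/-- The components of a pair `⟨p, q⟩ = p 0, q 0, p 1, q 1, …`. -/
def left (r : ℕ → ℕ) : ℕ → ℕ := fun i => r (2 * i)

def right (r : ℕ → ℕ) : ℕ → ℕ := fun i => r (2 * i + 1)

theorem exists_pair (p q : ℕ → ℕ) : ∃ r, left r = p ∧ right r = q := by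
  refine ⟨fun i => if i % 2 = 0 then p (i / 2) else q (i / 2), ?_, ?_⟩
  · funext i; simp [left]
  · funext i
    have h1 : (2 * i + 1) % 2 = 1 := by omega
    have h2 : (2 * i + 1) / 2 = i := by omega
    simp [right, h1, h2]

/-- The product representation. -/
def Representation.prod {X Y : Type} (δ : Representation X) (γ : Representation Y) :
    Representation (X × Y) where
  IsName r z := δ.IsName (left r) z.1 ∧ γ.IsName (right r) z.2
  unique h h' := Prod.ext (δ.unique h.1 h'.1) (γ.unique h.2 h'.2)
  surj z := by
    obtain ⟨p, hp⟩ := δ.surj z.1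
    obtain ⟨q, hq⟩ := γ.surj z.2
    obtain ⟨r, rfl, rfl⟩ := exists_pair p q
    exact ⟨r, hp, hq⟩

/-- A problem (partial multi-valued function): to each instance its set of results. -/
abbrev Problem (X Y : Type) := X → Set Y

/-- The admissible instances. -/
def Problem.dom {X Y : Type} (f : Problem X Y) : Set X := {x | (f x).Nonempty}

/-- The problem `f` has a computable realizer: some Type-2 machine turns every name of every
admissible instance into a name of a result. -/
def Problem.IsComputable {X Y : Type} (δ : Representation X) (γ : Representation Y)
    (f : Problem X Y) : Prop :=
  ∃ M : TypeTwoMachine, ∀ p x, δ.IsName p x → x ∈ f.dom →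
    ∃ q y, M.Writes p q ∧ γ.IsName q y ∧ y ∈ f x

/-! ### Euclidean space as a computable metric space -/

abbrev Space (n : ℕ) := EuclideanSpace ℝ (Fin n)

/-- An effective numbering of the rationals. -/
def ratNum (k : ℕ) : ℚ := (Denumerable.ofNat ℤ k.unpair.1 : ℚ) / (k.unpair.2 + 1)

/-- An effective numbering of the points of `ℝⁿ` with rational coordinates: the number of a finite
list of naturals stands for the point whose coordinates are numbered by the entries. -/
def ratPoint (n : ℕ) (k : ℕ) : Space n :=
  WithLp.toLp 2 fun j => (ratNum ((Denumerable.ofNat (List ℕ) k).getD j 0) : ℝ)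

theorem ratNum_surjective : Function.Surjective ratNum := by
  intro q
  refine ⟨Nat.pair (Encodable.encode q.num) (q.den - 1), ?_⟩
  have h : ((q.den - 1 : ℕ) : ℚ) + 1 = q.den := by
    have := q.den_pos
    exact_mod_cast Nat.sub_add_cancel this
  rw [ratNum, Nat.unpair_pair]
  dsimp only
  rw [Denumerable.ofNat_encode, h, Rat.num_div_den]

theorem exists_ratPoint (n : ℕ) (v : Fin n → ℚ) :
    ∃ k, ratPoint n k = WithLp.toLp 2 fun j => (v j : ℝ) := by
  choose g hg using ratNum_surjective
  refine ⟨Encodable.encode (List.ofFn fun j => g (v j)), ?_⟩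
  simp [ratPoint, hg]

theorem denseRange_ratPoint (n : ℕ) : DenseRange (ratPoint n) := by
  have h1 : DenseRange (Pi.map fun (_ : Fin n) (q : ℚ) => (q : ℝ)) :=
    DenseRange.piMap fun _ => Rat.denseRange_cast
  have h2 : DenseRange (WithLp.toLp 2 : (Fin n → ℝ) → Space n) :=
    (WithLp.toLp_surjective 2).denseRange
  refine (h2.comp h1 (PiLp.continuous_toLp 2 _)).mono ?_
  rintro _ ⟨v, rfl⟩
  obtain ⟨k, hk⟩ := exists_ratPoint n v
  exact ⟨k, hk⟩

/-- The Cauchy representation of `ℝⁿ`. -/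
def cauchyRep (n : ℕ) : Representation (Space n) where
  IsName p x := Filter.Tendsto (fun i => ratPoint n (p i)) Filter.atTop (𝓝 x) ∧
    ∀ i, dist (ratPoint n (p i)) x < 2⁻¹ ^ i
  unique h h' := tendsto_nhds_unique h.1 h'.1
  surj x := by
    have h : ∀ i : ℕ, ∃ k, dist (ratPoint n k) x < 2⁻¹ ^ i := fun i => by
      obtain ⟨k, hk⟩ := (denseRange_ratPoint n).exists_dist_lt x
        (show (0 : ℝ) < 2⁻¹ ^ i by positivity)
      exact ⟨k, by rwa [dist_comm]⟩
    choose p hp using h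
    refine ⟨p, ?_, hp⟩
    rw [tendsto_iff_dist_tendsto_zero]
    exact squeeze_zero (fun _ => dist_nonneg) (fun i => (hp i).le)
      (tendsto_pow_atTop_nhds_zero_of_lt_one (by norm_num) (by norm_num))

/-- The standard enumeration of the rational open balls (radius `0` allowed). -/
def ratBall (n : ℕ) (i : ℕ) : Set (Space n) :=
  Metric.ball (ratPoint n i.unpair.1)
    ((i.unpair.2.unpair.1 : ℝ) / (i.unpair.2.unpair.2 + 1))

theorem exists_ratBall_subset {n : ℕ} {U : Set (Space n)} (hU : IsOpen U) {x : Space n}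
    (hx : x ∈ U) : ∃ i, x ∈ ratBall n i ∧ ratBall n i ⊆ U := by
  obtain ⟨r, hr, hrU⟩ := Metric.isOpen_iff.1 hU x hx
  obtain ⟨m, hm⟩ := exists_nat_one_div_lt (half_pos hr)
  obtain ⟨k, hk⟩ := (denseRange_ratPoint n).exists_dist_lt x
    (show (0 : ℝ) < 1 / ((m : ℝ) + 1) by positivity)
  refine ⟨Nat.pair k (Nat.pair 1 m), by simpa [ratBall] using hk, fun y hy => hrU ?_⟩
  simp only [ratBall, Nat.unpair_pair, Metric.mem_ball, Nat.cast_one] at hy ⊢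
  linarith [dist_triangle y (ratPoint n k) x, dist_comm x (ratPoint n k)]

theorem ratBall_empty (n : ℕ) : ratBall n 0 = ∅ := by
  simp [ratBall, Nat.unpair_zero]

/-- The closed subsets of `ℝⁿ`. -/
abbrev ClosedSet (n : ℕ) := TopologicalSpace.Closeds (Space n)

/-- Negative information: `p` lists rational balls that exhaust the complement of `F`. -/
def negRep (n : ℕ) : Representation (ClosedSet n) where
  IsName p F := (F : Set (Space n)) = (⋃ i ∈ Set.range p, ratBall n i)ᶜ
  unique h h' := SetLike.coe_injective (h.trans h'.symm)
  surj F := by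
    classical
    refine ⟨fun i => if Disjoint (ratBall n i) F then i else 0, ?_⟩
    ext x
    simp only [Set.mem_range, Set.mem_compl_iff, Set.mem_iUnion, exists_prop, not_exists, not_and]
    constructor
    · rintro hx _ ⟨i, rfl⟩ hi
      split_ifs at hi with h
      · exact Set.disjoint_left.1 h hi hx
      · simp [ratBall_empty] at hi
    · intro h
      by_contra hx
      obtain ⟨i, hxi, hi⟩ := exists_ratBall_subset F.isClosed.isOpen_compl hx
      exact h i ⟨i, if_pos (Set.disjoint_left.2 hi)⟩ hxi

/-- Positive information: `p` lists (shifted by `1`) exactly the rational balls that meet `F`. -/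
def posRep (n : ℕ) : Representation (ClosedSet n) where
  IsName p F := ∀ i, i + 1 ∈ Set.range p ↔ (ratBall n i ∩ F).Nonempty
  unique {p F G} h h' := by
    have key : ∀ {A B : ClosedSet n}, (∀ i, i + 1 ∈ Set.range p ↔ (ratBall n i ∩ A).Nonempty) →
        (∀ i, i + 1 ∈ Set.range p ↔ (ratBall n i ∩ B).Nonempty) → ∀ x ∈ A, x ∈ B := by
      intro A B hA hB x hx
      by_contra hxB
      obtain ⟨i, hxi, hi⟩ := exists_ratBall_subset B.isClosed.isOpen_compl hxB
      obtain ⟨y, hy, hyB⟩ := (hB i).1 ((hA i).2 ⟨x, hxi, hx⟩)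
      exact hi hy hyB
    exact SetLike.ext fun x => ⟨key h h' x, key h' h x⟩
  surj F := by
    classical
    refine ⟨fun i => if (ratBall n (i - 1) ∩ F).Nonempty then i else 0, fun i => ?_⟩
    constructor
    · rintro ⟨j, hj⟩
      dsimp only at hj
      split_ifs at hj with h
      subst hj
      simpa using h
    · intro h
      exact ⟨i + 1, if_pos (by simpa using h)⟩

/-- Total information: `⟨p, q⟩` with `p` negative and `q` positive information on `F`. -/
def totalRep (n : ℕ) : Representation (ClosedSet n) where
  IsName r F := (negRep n).IsName (left r) F ∧ (posRep n).IsName (right r) F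
  unique h h' := (negRep n).unique h.1 h'.1
  surj F := by
    obtain ⟨p, hp⟩ := (negRep n).surj F
    obtain ⟨q, hq⟩ := (posRep n).surj F
    obtain ⟨r, rfl, rfl⟩ := exists_pair p q
    exact ⟨r, hp, hq⟩

/-! ### Dyadic cubes -/

/-- The index `(k, m)` of the closed dyadic cube with edge length `2 ^ (-k)` and lower corner
`2 ^ (-k) • m`; for `n ≥ 1` different indices give different cubes. -/
abbrev DyadicCube (n : ℕ) := ℤ × (Fin n → ℤ)

/-- The cube as a set of points: the product of the intervals
`[m j * 2 ^ (-k), (m j + 1) * 2 ^ (-k)]`. -/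
def DyadicCube.toSet {n : ℕ} (Q : DyadicCube n) : Set (Space n) :=
  {x | ∀ j, (Q.2 j : ℝ) * 2 ^ (-Q.1) ≤ x j ∧ x j ≤ ((Q.2 j : ℝ) + 1) * 2 ^ (-Q.1)}

def DyadicCube.center {n : ℕ} (Q : DyadicCube n) : Space n :=
  WithLp.toLp 2 fun j => ((Q.2 j : ℝ) + 1 / 2) * 2 ^ (-Q.1)

/-- The enlarged cube `Q*`: the image of `Q` under `x ↦ (1 + ε) (x - c) + c`, `c` the center. -/
def DyadicCube.enlarged {n : ℕ} (ε : ℚ) (Q : DyadicCube n) : Set (Space n) :=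
  (fun x => (1 + (ε : ℝ)) • (x - Q.center) + Q.center) '' Q.toSet

/-- The code of a cube. The index `(k, m)` and the pair of `k` and the center `2 ^ (-k) (m + 1/2)`
determine each other effectively. -/
def DyadicCube.code {n : ℕ} (Q : DyadicCube n) : ℕ :=
  Nat.pair (Encodable.encode Q.1) (Encodable.encode (List.ofFn fun j => Encodable.encode (Q.2 j)))

theorem DyadicCube.code_injective {n : ℕ} :
    Function.Injective (DyadicCube.code : DyadicCube n → ℕ) := by
  rintro ⟨k, m⟩ ⟨k', m'⟩ h
  obtain ⟨h1, h2⟩ := Nat.pair_eq_pair.1 h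
  have h3 := List.ofFn_injective (Encodable.encode_injective h2)
  refine Prod.ext (Encodable.encode_injective h1) (funext fun j => ?_)
  exact Encodable.encode_injective (congrFun h3 j)

/-- Sets of cubes are represented by their characteristic functions: `Q` belongs to the set
named by `p` iff `p` has the value `1` at the code of `Q`. -/
def cubeSetRep (n : ℕ) : Representation (Set (DyadicCube n)) where
  IsName p S := S = {Q | p Q.code = 1}
  unique h h' := h.trans h'.symm
  surj S := by
    classical
    refine ⟨fun i => if ∃ Q ∈ S, DyadicCube.code Q = i then 1 else 0, ?_⟩
    ext Q
    simp only [Set.mem_ofPred_eq, ite_eq_left_iff, zero_ne_one, imp_false, not_not]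
    constructor
    · exact fun h => ⟨Q, h, rfl⟩
    · rintro ⟨Q', h, h'⟩
      exact DyadicCube.code_injective h' ▸ h

/-- Finite sets of cubes are given by one natural number: `q` names `G` if its first entry is the
code of a list of (the codes of) exactly the members of `G`. -/
def finCubesRep (n : ℕ) : Representation (Finset (DyadicCube n)) where
  IsName q G := ∃ l : List (DyadicCube n),
    q 0 = Encodable.encode (l.map DyadicCube.code) ∧ ∀ Q, Q ∈ l ↔ Q ∈ G
  unique := by
    rintro p G G' ⟨l, hl, h⟩ ⟨l', hl', h'⟩
    have : l = l' := List.map_injective_iff.2 DyadicCube.code_injective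
      (Encodable.encode_injective (hl.symm.trans hl'))
    subst this
    exact Finset.ext fun Q => (h Q).symm.trans (h' Q)
  surj G := ⟨fun _ => Encodable.encode (G.toList.map DyadicCube.code), G.toList, rfl, by simp⟩

/-! ### Whitney families -/

/-- The distance of two sets. -/
def setDist {n : ℕ} (A B : Set (Space n)) : ℝ := sInf (Set.image2 dist A B)

/-- The problem of decomposing the complement of a nonempty closed set `F` into dyadic cubes with
disjoint interiors whose diameters are comparable to their distances from `F`. -/
def CUBE (n : ℕ) : Problem (ClosedSet n) (Set (DyadicCube n)) := fun F =>
  {W | (F : Set (Space n)).Nonempty ∧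
    (⋃ Q ∈ W, DyadicCube.toSet Q) = (F : Set (Space n))ᶜ ∧
    (∀ Q ∈ W, ∀ Q' ∈ W, Q ≠ Q' → interior Q.toSet ∩ interior Q'.toSet = ∅) ∧
    ∀ Q ∈ W, 1 / 2 * Metric.diam Q.toSet < setDist Q.toSet F ∧
      setDist Q.toSet F < 5 * Metric.diam Q.toSet}

/-- The cubes of the family `W` whose enlargements contain `x`. -/
def cubesAt {n : ℕ} (ε : ℚ) (W : Set (DyadicCube n)) (x : Space n) : Set (DyadicCube n) :=
  {Q ∈ W | x ∈ Q.enlarged ε}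

/-- The problem that asks, for a Whitney family `W` of `F` and a point `x ∉ F`, for a finite set of
cubes of `W` that contains all cubes whose enlargements contain `x` and that has at most
`⌈197 √n⌉ ^ n` members. -/
def nearCubes (n : ℕ) (ε : ℚ) :
    Problem (ClosedSet n × Set (DyadicCube n) × Space n) (Finset (DyadicCube n)) := fun z =>
  {G | z.2.1 ∈ CUBE n z.1 ∧ z.2.2 ∉ z.1 ∧ (G : Set (DyadicCube n)) ⊆ z.2.1 ∧
    cubesAt ε z.2.1 z.2.2 ⊆ G ∧ G.card ≤ ⌈197 * √(n : ℝ)⌉₊ ^ n}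

end Whitney

end

/-! (a) Put σ = `sqrtBound n`, so √n < σ ≤ 2√n. For a dyadic cube with side s and centre c, consider
the conditions "F stays farther than σs from c" and "F has a point within (σ + 1/4)s of c". Negative
information confirms the first by compactness (`exists_avoids`), positive information confirms the
second (`exists_meets`). Since they overlap, racing the two tests ends with a verdict on every cube
(`accepts_or_rejects`); in the overlap the verdict depends on the name of F, which a multi-valued
problem permits.

The family consists of the maximal accepted cubes. Their interiors are disjoint because dyadic cubes
are nested or non-overlapping. They cover the complement of F because small cubes around x ∉ F are
accepted, while large cubes around x come too close to a point of F. Acceptance puts F at distance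
more than (σ - √n/2)s > √n s/2; rejection of the parent puts F at distance less than (2σ + 1/2 +
√n/2)s ≤ 5√n s. Maximality concerns infinitely many ancestors, but one known point of F excludes all
large ones, so membership is decidable.

(b) Search for Q ∈ W close to x. By the distance bounds, cubes of W whose enlargements contain x
have levels within 3 of that of Q, hence lie in an explicit finite list around the third ancestor of
Q (`mem_candidates_of_near`). Filtering the list by the characteristic function of W gives the
answer. Disjointness bounds its size by 129^n (`card_le_of_subset_candidates`).

Both algorithms are unbounded searches with primitive recursive tests on prefixes of the name;
`Problem.isComputable_of_search` turns these into machines. -/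

noncomputable section

namespace Whitney

/-! ### Primitive recursive integer and rational arithmetic -/

section PrimrecArithmetic

variable {α : Type*} [Primcodable α]

theorem encode_natCast_int (m : ℕ) : Encodable.encode (m : ℤ) = 2 * m := by
  change Equiv.intEquivNat (Int.ofNat m) = 2 * m
  rfl

theorem encode_negSucc (m : ℕ) : Encodable.encode (Int.negSucc m) = 2 * m + 1 := by
  change Equiv.intEquivNat (Int.negSucc m) = 2 * m + 1
  simp [Equiv.intEquivNat, Equiv.intEquivNatSumNat]

theorem primrec_natCast_sub : Primrec₂ fun a b : ℕ => (a : ℤ) - b := by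
  have h1 : Primrec₂ fun a b : ℕ => 2 * (a - b) :=
    Primrec.nat_mul.comp (Primrec.const 2) Primrec.nat_sub
  have h2 : Primrec₂ fun a b : ℕ => 2 * (b - a - 1) + 1 :=
    Primrec.succ.comp (Primrec.nat_mul.comp (Primrec.const 2)
      (Primrec.nat_sub.comp (Primrec.nat_sub.comp Primrec.snd Primrec.fst) (Primrec.const 1)))
  have h3 := Primrec.ite (Primrec.nat_le.comp (Primrec.snd (α := ℕ)) (Primrec.fst (β := ℕ))) h1 h2
  refine Primrec₂.encode_iff.1 (h3.of_eq ?_)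
  rintro ⟨a, b⟩
  dsimp only
  split_ifs with h
  · rw [← Nat.cast_sub h]
    exact (encode_natCast_int _).symm
  · have : (a : ℤ) - b = Int.negSucc (b - a - 1) := by omega
    rw [this]
    exact (encode_negSucc _).symm

/-- Even codes are the naturals and odd codes the negative integers. This reduces integer arithmetic
to pairs of naturals. -/
theorem int_eq_sub_encode (z : ℤ) :
    z = ((if Encodable.encode z % 2 = 0 then Encodable.encode z / 2 else 0 : ℕ) : ℤ) -
      (if Encodable.encode z % 2 = 0 then 0 else Encodable.encode z / 2 + 1 : ℕ) := by
  rcases z with m | m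
  · have h : Encodable.encode (Int.ofNat m) = 2 * m := encode_natCast_int m
    rw [h, if_pos (by omega), if_pos (by omega)]
    simp
  · rw [encode_negSucc, if_neg (by omega), if_neg (by omega)]
    omega

theorem primrec_int_iff {f : α → ℤ} :
    Primrec f ↔ ∃ a b : α → ℕ, Primrec a ∧ Primrec b ∧ ∀ x, f x = a x - b x := by
  constructor
  · intro h
    have he : Primrec fun x => Encodable.encode (f x) := Primrec.encode.comp h
    have h0 : PrimrecPred fun x => Encodable.encode (f x) % 2 = 0 :=
      Primrec.eq.comp (Primrec.nat_mod.comp he (Primrec.const 2)) (Primrec.const 0)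
    have h2 : Primrec fun x => Encodable.encode (f x) / 2 :=
      Primrec.nat_div.comp he (Primrec.const 2)
    exact ⟨_, _, Primrec.ite h0 h2 (Primrec.const 0),
      Primrec.ite h0 (Primrec.const 0) (Primrec.succ.comp h2), fun x => int_eq_sub_encode (f x)⟩
  · rintro ⟨a, b, ha, hb, h⟩
    exact (primrec_natCast_sub.comp ha hb).of_eq fun x => (h x).symm

theorem primrec_natCast_int {f : α → ℕ} (hf : Primrec f) : Primrec fun x => (f x : ℤ) :=
  primrec_int_iff.2 ⟨f, fun _ => 0, hf, Primrec.const 0, by simp⟩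

theorem primrec_int_sub {f g : α → ℤ} (hf : Primrec f) (hg : Primrec g) :
    Primrec fun x => f x - g x := by
  obtain ⟨a, b, ha, hb, h⟩ := primrec_int_iff.1 hf
  obtain ⟨c, d, hc, hd, h'⟩ := primrec_int_iff.1 hg
  refine primrec_int_iff.2 ⟨fun x => a x + d x, fun x => b x + c x, Primrec.nat_add.comp ha hd,
    Primrec.nat_add.comp hb hc, fun x => ?_⟩
  rw [h, h']
  push_cast
  ring

theorem primrec_int_add {f g : α → ℤ} (hf : Primrec f) (hg : Primrec g) :
    Primrec fun x => f x + g x :=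
  (primrec_int_sub hf (primrec_int_sub (Primrec.const 0) hg)).of_eq fun x => by ring

theorem primrec_int_mul_natCast {f : α → ℤ} {g : α → ℕ} (hf : Primrec f) (hg : Primrec g) :
    Primrec fun x => f x * g x := by
  obtain ⟨a, b, ha, hb, h⟩ := primrec_int_iff.1 hf
  refine primrec_int_iff.2 ⟨fun x => a x * g x, fun x => b x * g x, Primrec.nat_mul.comp ha hg,
    Primrec.nat_mul.comp hb hg, fun x => ?_⟩
  rw [h]
  push_cast
  ring

theorem primrec_int_div_natCast {f : α → ℤ} {g : α → ℕ} (hf : Primrec f) (hg : Primrec g)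
    (hpos : ∀ x, 0 < g x) : Primrec fun x => f x / g x := by
  obtain ⟨a, b, ha, hb, h⟩ := primrec_int_iff.1 hf
  -- Floor division of a possibly negative numerator: adding b * g makes it the natural number a + b
  -- * (g - 1) and raises the quotient by exactly b.
  refine primrec_int_iff.2 ⟨fun x => (a x + b x * (g x - 1)) / g x, b,
    Primrec.nat_div.comp (Primrec.nat_add.comp ha (Primrec.nat_mul.comp hb
      (Primrec.nat_sub.comp hg (Primrec.const 1)))) hg, hb, fun x => ?_⟩
  have h1 := hpos x
  have h2 : ((a x + b x * (g x - 1) : ℕ) : ℤ) = (a x - b x) + b x * g x := by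
    push_cast [Nat.cast_sub (show 1 ≤ g x from h1)]
    ring
  dsimp only
  rw [h, Int.natCast_div, h2, Int.add_mul_ediv_right _ _ (by omega)]
  ring

theorem primrec_two_pow {f : α → ℕ} (hf : Primrec f) : Primrec fun x => 2 ^ f x :=
  (Primrec₂.unpaired'.1 Nat.Primrec.pow).comp (Primrec.const 2) hf

theorem primrec_nat_pow {f g : α → ℕ} (hf : Primrec f) (hg : Primrec g) :
    Primrec fun x => f x ^ g x :=
  (Primrec₂.unpaired'.1 Nat.Primrec.pow).comp hf hg

/-- Functions with rational values that are computed by primitive recursive numerators and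
denominators. -/
def PrimrecReal (f : α → ℝ) : Prop :=
  ∃ a b c : α → ℕ, Primrec a ∧ Primrec b ∧ Primrec c ∧ ∀ x, f x = (a x - b x) / (c x + 1)

namespace PrimrecReal

variable {f g : α → ℝ}

theorem comp {β : Type*} [Primcodable β] {f : β → ℝ} {h : α → β} (hf : PrimrecReal f)
    (hh : Primrec h) : PrimrecReal fun x => f (h x) := by
  obtain ⟨a, b, c, ha, hb, hc, e⟩ := hf
  exact ⟨_, _, _, ha.comp hh, hb.comp hh, hc.comp hh, fun x => e (h x)⟩

theorem of_eq (hf : PrimrecReal f) (h : ∀ x, f x = g x) : PrimrecReal g :=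
  (funext h : f = g) ▸ hf

theorem intCast {h : α → ℤ} (hh : Primrec h) : PrimrecReal fun x => (h x : ℝ) := by
  obtain ⟨a, b, ha, hb, e⟩ := primrec_int_iff.1 hh
  refine ⟨a, b, fun _ => 0, ha, hb, Primrec.const 0, fun x => ?_⟩
  dsimp only
  rw [e]
  push_cast
  ring

theorem natCast {h : α → ℕ} (hh : Primrec h) : PrimrecReal fun x => (h x : ℝ) :=
  (intCast (primrec_natCast_int hh)).of_eq fun x => by simp

theorem inv_natCast_succ {h : α → ℕ} (hh : Primrec h) :
    PrimrecReal fun x => ((h x : ℝ) + 1)⁻¹ :=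
  ⟨fun _ => 1, fun _ => 0, h, Primrec.const 1, Primrec.const 0, hh, fun x => by simp⟩

theorem mul (hf : PrimrecReal f) (hg : PrimrecReal g) : PrimrecReal fun x => f x * g x := by
  obtain ⟨a, b, c, ha, hb, hc, e⟩ := hf
  obtain ⟨a', b', c', ha', hb', hc', e'⟩ := hg
  -- The new denominator is (c + 1)(c' + 1) = (c c' + c + c') + 1.
  refine ⟨fun x => a x * a' x + b x * b' x, fun x => a x * b' x + b x * a' x,
    fun x => c x * c' x + (c x + c' x),
    Primrec.nat_add.comp (Primrec.nat_mul.comp ha ha') (Primrec.nat_mul.comp hb hb'),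
    Primrec.nat_add.comp (Primrec.nat_mul.comp ha hb') (Primrec.nat_mul.comp hb ha'),
    Primrec.nat_add.comp (Primrec.nat_mul.comp hc hc') (Primrec.nat_add.comp hc hc'),
    fun x => ?_⟩
  dsimp only
  rw [e, e', div_mul_div_comm]
  push_cast
  congr 1 <;> ring

theorem sub (hf : PrimrecReal f) (hg : PrimrecReal g) : PrimrecReal fun x => f x - g x := by
  obtain ⟨a, b, c, ha, hb, hc, e⟩ := hf
  obtain ⟨a', b', c', ha', hb', hc', e'⟩ := hg
  refine ⟨fun x => a x * (c' x + 1) + b' x * (c x + 1),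
    fun x => b x * (c' x + 1) + a' x * (c x + 1),
    fun x => c x * c' x + (c x + c' x),
    Primrec.nat_add.comp (Primrec.nat_mul.comp ha (Primrec.succ.comp hc'))
      (Primrec.nat_mul.comp hb' (Primrec.succ.comp hc)),
    Primrec.nat_add.comp (Primrec.nat_mul.comp hb (Primrec.succ.comp hc'))
      (Primrec.nat_mul.comp ha' (Primrec.succ.comp hc)),
    Primrec.nat_add.comp (Primrec.nat_mul.comp hc hc') (Primrec.nat_add.comp hc hc'),
    fun x => ?_⟩
  have h1 : (c x : ℝ) + 1 ≠ 0 := by positivity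
  have h2 : (c' x : ℝ) + 1 ≠ 0 := by positivity
  dsimp only
  rw [e, e', div_sub_div _ _ h1 h2]
  push_cast
  congr 1 <;> ring

theorem const (q : ℚ) : PrimrecReal fun _ : α => (q : ℝ) := by
  refine ((intCast (Primrec.const q.num)).mul
    (inv_natCast_succ (Primrec.const (q.den - 1)))).of_eq fun _ => ?_
  have h : ((q.den - 1 : ℕ) : ℝ) + 1 = q.den := by
    exact_mod_cast Nat.sub_add_cancel q.den_pos
  rw [h, ← div_eq_mul_inv]
  exact_mod_cast Rat.num_div_den q

theorem add (hf : PrimrecReal f) (hg : PrimrecReal g) : PrimrecReal fun x => f x + g x :=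
  (hf.sub ((const 0).sub hg)).of_eq fun x => by simp

theorem pow_two (hf : PrimrecReal f) : PrimrecReal fun x => f x ^ 2 :=
  (hf.mul hf).of_eq fun x => (sq (f x)).symm

theorem two_zpow_neg {h : α → ℤ} (hh : Primrec h) :
    PrimrecReal fun x => (2 : ℝ) ^ (-h x) := by
  obtain ⟨a, b, ha, hb, e⟩ := primrec_int_iff.1 hh
  refine ((natCast (primrec_two_pow hb)).mul (inv_natCast_succ (Primrec.nat_sub.comp
    (primrec_two_pow ha) (Primrec.const 1)))).of_eq fun x => ?_
  have h1 : ((2 ^ a x - 1 : ℕ) : ℝ) + 1 = 2 ^ a x := by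
    exact_mod_cast Nat.sub_add_cancel Nat.one_le_two_pow
  rw [h1, e, neg_sub, zpow_sub₀ two_ne_zero, zpow_natCast, zpow_natCast]
  push_cast
  rw [div_eq_mul_inv]

theorem sum {ι : Type*} (s : Finset ι) {f : ι → α → ℝ} (hf : ∀ i, PrimrecReal (f i)) :
    PrimrecReal fun x => ∑ i ∈ s, f i x := by
  classical
  induction s using Finset.induction_on with
  | empty => exact (const 0).of_eq fun x => by simp
  | insert i s hi ih => exact ((hf i).add ih).of_eq fun x => by rw [Finset.sum_insert hi]

theorem le (hf : PrimrecReal f) (hg : PrimrecReal g) : PrimrecPred fun x => f x ≤ g x := by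
  obtain ⟨a, b, c, ha, hb, hc, e⟩ := hf
  obtain ⟨a', b', c', ha', hb', hc', e'⟩ := hg
  refine (Primrec.nat_le.comp
    (Primrec.nat_add.comp (Primrec.nat_mul.comp ha (Primrec.succ.comp hc'))
      (Primrec.nat_mul.comp hb' (Primrec.succ.comp hc)))
    (Primrec.nat_add.comp (Primrec.nat_mul.comp ha' (Primrec.succ.comp hc))
      (Primrec.nat_mul.comp hb (Primrec.succ.comp hc')))).of_eq fun x => ?_
  rw [e, e', div_le_div_iff₀ (by positivity) (by positivity), ← Nat.cast_le (α := ℝ)]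
  push_cast
  constructor <;> intro h <;> linarith

theorem lt (hf : PrimrecReal f) (hg : PrimrecReal g) : PrimrecPred fun x => f x < g x :=
  (hg.le hf).not.of_eq fun _ => not_le

end PrimrecReal

theorem primrecPred_exists_lt {p : α → ℕ → Prop} {b : α → ℕ}
    (hp : PrimrecPred fun z : α × ℕ => p z.1 z.2) (hb : Primrec b) :
    PrimrecPred fun x => ∃ i < b x, p x i := by
  have h : PrimrecRel fun (i : ℕ) (x : α) => p x i :=
    hp.comp (Primrec.pair Primrec.snd Primrec.fst)
  exact (h.exists_mem_list.comp (Primrec.list_range.comp hb) Primrec.id).of_eq fun x => by simp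

theorem primrecPred_forall_lt {p : α → ℕ → Prop} {b : α → ℕ}
    (hp : PrimrecPred fun z : α × ℕ => p z.1 z.2) (hb : Primrec b) :
    PrimrecPred fun x => ∀ i < b x, p x i :=
  (primrecPred_exists_lt (p := fun x i => ¬p x i) hp.not hb).not.of_eq fun x => by
    simp only [not_exists, not_and, not_not]

theorem primrecPred_forall_fin {n : ℕ} {p : Fin n → α → Prop} (hp : ∀ j, PrimrecPred (p j)) :
    PrimrecPred fun x => ∀ j, p j x := by
  induction n with
  | zero => exact (Primrec.eq.comp (Primrec.const 0) (Primrec.const 0)).of_eq fun x => by simp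
  | succ n ih =>
    exact ((hp 0).and (ih fun j => hp j.succ)).of_eq fun x =>
      (Fin.forall_fin_succ (P := fun j => p j x)).symm

end PrimrecArithmetic

/-! ### Machines that search for a verifiable answer -/

/-- The first `t` entries of `p`. -/
def initialPart (p : ℕ → ℕ) (t : ℕ) : List ℕ := (List.range t).map p

theorem initialPart_succ (p : ℕ → ℕ) (t : ℕ) :
    initialPart p (t + 1) = initialPart p t ++ [p t] := by
  simp [initialPart, List.range_succ]

theorem length_initialPart (p : ℕ → ℕ) (t : ℕ) : (initialPart p t).length = t := by
  simp [initialPart]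

theorem getD_initialPart (p : ℕ → ℕ) {t i : ℕ} (h : i < t) : (initialPart p t).getD i 0 = p i := by
  simp [initialPart, List.getD, h]

/-- The symbol written by a searching machine that has read `L` and written `i` symbols: the length
of `L` determines the guess that is tested. -/
def searchOutput (R : List ℕ → ℕ → ℕ → Prop) (out : List ℕ → ℕ → ℕ → ℕ) (L : List ℕ) (i : ℕ) :
    Option ℕ :=
  open Classical in
  if R L i L.length.unpair.1 then some (out L i L.length.unpair.1) else none

theorem primrec_searchOutput {R : List ℕ → ℕ → ℕ → Prop} {out : List ℕ → ℕ → ℕ → ℕ}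
    (hR : PrimrecPred fun z : List ℕ × ℕ × ℕ => R z.1 z.2.1 z.2.2)
    (hout : Primrec fun z : List ℕ × ℕ × ℕ => out z.1 z.2.1 z.2.2) :
    Primrec₂ (searchOutput R out) := by
  have hg : Primrec fun z : List ℕ × ℕ => (z.1, z.2, z.1.length.unpair.1) :=
    Primrec.fst.pair (Primrec.snd.pair (Primrec.fst.comp (Primrec.unpair.comp
      (Primrec.list_length.comp Primrec.fst))))
  classical
  exact (Primrec.ite (hR.comp hg) (Primrec.option_some.comp (hout.comp hg))
    (Primrec.const none)).of_eq fun z => by simp only [searchOutput]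

def searchStep (g : List ℕ → ℕ → Option ℕ) (z : ℕ × ℕ) : ℕ × Bool × Option ℕ :=
  let s := Denumerable.ofNat (List ℕ × ℕ) z.1
  let L := s.1 ++ [z.2]
  (Encodable.encode (L, s.2 + (g L s.2).toList.length), true, g L s.2)

theorem primrec_searchStep {g : List ℕ → ℕ → Option ℕ} (hg : Primrec₂ g) :
    Primrec (searchStep g) := by
  have hs : Primrec fun z : ℕ × ℕ => Denumerable.ofNat (List ℕ × ℕ) z.1 :=
    (Primrec.ofNat _).comp Primrec.fst
  have hL : Primrec fun z : ℕ × ℕ => (Denumerable.ofNat (List ℕ × ℕ) z.1).1 ++ [z.2] :=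
    Primrec.list_concat.comp (Primrec.fst.comp hs) Primrec.snd
  have hG := hg.comp hL (Primrec.snd.comp hs)
  exact (Primrec.encode.comp (hL.pair (Primrec.nat_add.comp (Primrec.snd.comp hs)
    (Primrec.list_length.comp (Primrec.optionToList.comp hG))))).pair
    ((Primrec.const true).pair hG)

/-- The input head advances at every step, so time, head position and length of the stored prefix
coincide. -/
theorem run_searchStep {g : List ℕ → ℕ → Option ℕ} (hg : Computable (searchStep g)) (p : ℕ → ℕ)
    (t : ℕ) :
    ((⟨searchStep g, hg⟩ : TypeTwoMachine).run p t).config = Encodable.encode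
      (initialPart p t, ((⟨searchStep g, hg⟩ : TypeTwoMachine).run p t).output.length) ∧
    ((⟨searchStep g, hg⟩ : TypeTwoMachine).run p t).head = t := by
  induction t with
  | zero => exact ⟨rfl, rfl⟩
  | succ t ih =>
    simp only [TypeTwoMachine.run]
    rw [ih.1, ih.2]
    simp [searchStep, initialPart_succ]

theorem output_searchStep {g : List ℕ → ℕ → Option ℕ} (hg : Computable (searchStep g)) (p : ℕ → ℕ)
    (t : ℕ) :
    ((⟨searchStep g, hg⟩ : TypeTwoMachine).run p (t + 1)).output =
      ((⟨searchStep g, hg⟩ : TypeTwoMachine).run p t).output ++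
        (g (initialPart p (t + 1))
          ((⟨searchStep g, hg⟩ : TypeTwoMachine).run p t).output.length).toList := by
  conv_lhs => simp only [TypeTwoMachine.run]
  rw [(run_searchStep hg p t).1, (run_searchStep hg p t).2]
  simp [searchStep, initialPart_succ]

/-- A problem is computable if the entries of a result can be found by unbounded search, where
candidates are verified by a primitive recursive test of initial parts of a name of the instance
that accepts some candidate from some time on. -/
theorem Problem.isComputable_of_search {X Y : Type} {δ : Representation X} {γ : Representation Y}
    {f : Problem X Y} {R : List ℕ → ℕ → ℕ → Prop} {out : List ℕ → ℕ → ℕ → ℕ}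
    (hR : PrimrecPred fun z : List ℕ × ℕ × ℕ => R z.1 z.2.1 z.2.2)
    (hout : Primrec fun z : List ℕ × ℕ × ℕ => out z.1 z.2.1 z.2.2)
    (H : ∀ p x, δ.IsName p x → x ∈ f.dom →
      (∀ i, ∃ w, ∀ᶠ t in Filter.atTop, R (initialPart p t) i w) ∧
      ∀ q : ℕ → ℕ, (∀ i, ∃ t w, R (initialPart p t) i w ∧ q i = out (initialPart p t) i w) →
        ∃ y, γ.IsName q y ∧ y ∈ f x) :
    f.IsComputable δ γ := by
  have hM := (primrec_searchStep (primrec_searchOutput hR hout)).to_comp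
  refine ⟨⟨_, hM⟩, fun p x hp hx => ?_⟩
  obtain ⟨H1, H2⟩ := H p x hp hx
  set M : TypeTwoMachine := ⟨_, hM⟩ with hMdef
  have hstep : ∀ t, (M.run p (t + 1)).output = (M.run p t).output ++
      (searchOutput R out (initialPart p (t + 1)) (M.run p t).output.length).toList :=
    output_searchStep hM p
  have hmono : Monotone fun t => (M.run p t).output.length :=
    monotone_nat_of_le_succ fun t => by rw [hstep, List.length_append]; omega
  have hsound : ∀ t i v, (M.run p t).output[i]? = some v →
      ∃ s w, R (initialPart p s) i w ∧ v = out (initialPart p s) i w := by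
    intro t
    induction t with
    | zero => intro i v h; simp [TypeTwoMachine.run] at h
    | succ t ih =>
      intro i v h
      rw [hstep, List.getElem?_append] at h
      split_ifs at h with hi
      · exact ih i v h
      · unfold searchOutput at h
        split_ifs at h with hc
        · rw [Option.toList_some, List.getElem?_singleton] at h
          split_ifs at h with h0
          have hi' : (M.run p t).output.length = i := by omega
          rw [hi'] at h hc
          exact ⟨_, _, hc, (Option.some.inj h).symm⟩
        · simp at h
  have hprogress : ∀ i, ∃ t, i ≤ (M.run p t).output.length := by
    intro i
    induction i with
    | zero => exact ⟨0, Nat.zero_le _⟩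
    | succ i ih =>
      obtain ⟨t₀, h₀⟩ := ih
      obtain ⟨w, hw⟩ := H1 i
      obtain ⟨t₁, h₁⟩ := Filter.eventually_atTop.1 hw
      -- Each guess w is tested at arbitrarily late times, namely at all prefix lengths `Nat.pair w
      -- s`; here s is taken past both thresholds.
      have hlt : t₀ + t₁ + 1 ≤ Nat.pair w (t₀ + t₁ + 1) := Nat.right_le_pair _ _
      obtain ⟨t, ht⟩ : ∃ t, Nat.pair w (t₀ + t₁ + 1) = t + 1 := ⟨_, (Nat.sub_add_cancel
        (show 1 ≤ Nat.pair w (t₀ + t₁ + 1) by omega)).symm⟩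
      have h1 : i ≤ (M.run p t).output.length := h₀.trans (hmono (show t₀ ≤ t by omega))
      -- Either symbol i is already written, or exactly i symbols are written and the guess w passes
      -- now.
      rcases h1.lt_or_eq with h2 | h2
      · exact ⟨t, h2⟩
      · refine ⟨t + 1, ?_⟩
        have h3 : R (initialPart p (t + 1)) i (initialPart p (t + 1)).length.unpair.1 := by
          rw [length_initialPart, ← ht, Nat.unpair_pair, ht]
          exact h₁ _ (by omega)
        rw [hstep, ← h2, searchOutput, if_pos h3]
        simp [← h2]
  have hval : ∀ i, ∃ t v, (M.run p t).output[i]? = some v := fun i => by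
    obtain ⟨t, ht⟩ := hprogress (i + 1)
    exact ⟨t, _, List.getElem?_eq_getElem ht⟩
  choose T q hq using hval
  obtain ⟨y, hy, hy'⟩ := H2 q fun i => hsound _ _ _ (hq i)
  exact ⟨q, y, fun i => ⟨T i, hq i⟩, hy, hy'⟩

/-! ### Geometry of dyadic cubes -/

theorem dist_le_sqrt_mul {n : ℕ} {x y : Space n} {r : ℝ} (hr : 0 ≤ r)
    (h : ∀ j, |x j - y j| ≤ r) : dist x y ≤ √n * r := by
  rw [EuclideanSpace.dist_eq, ← Real.sqrt_sq hr, ← Real.sqrt_mul (Nat.cast_nonneg n)]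
  refine Real.sqrt_le_sqrt ?_
  calc ∑ j, dist (x j) (y j) ^ 2 ≤ ∑ _j : Fin n, r ^ 2 :=
        Finset.sum_le_sum fun j _ => by
          rw [Real.dist_eq]
          exact pow_le_pow_left₀ (abs_nonneg _) (h j) 2
    _ = n * r ^ 2 := by simp

theorem abs_sub_apply_le_dist {n : ℕ} (x y : Space n) (j : Fin n) : |x j - y j| ≤ dist x y := by
  rw [dist_eq_norm, ← Real.norm_eq_abs]
  exact PiLp.norm_apply_le (x - y) j

theorem setDist_le_dist {n : ℕ} {A B : Set (Space n)} {x y : Space n} (hx : x ∈ A) (hy : y ∈ B) :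
    setDist A B ≤ dist x y := by
  refine csInf_le ⟨0, ?_⟩ (Set.mem_image2_of_mem hx hy)
  rintro _ ⟨a, -, b, -, rfl⟩
  exact dist_nonneg

theorem le_setDist {n : ℕ} {A B : Set (Space n)} (hA : A.Nonempty) (hB : B.Nonempty) {r : ℝ}
    (h : ∀ x ∈ A, ∀ y ∈ B, r ≤ dist x y) : r ≤ setDist A B := by
  refine le_csInf (hA.image2 hB) ?_
  rintro _ ⟨a, ha, b, hb, rfl⟩
  exact h a ha b hb

theorem exists_dist_lt_of_setDist_lt {n : ℕ} {A B : Set (Space n)} (hA : A.Nonempty)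
    (hB : B.Nonempty) {r : ℝ} (h : setDist A B < r) : ∃ x ∈ A, ∃ y ∈ B, dist x y < r := by
  by_contra! hcon
  exact absurd (le_setDist hA hB hcon) (not_le.2 h)

namespace DyadicCube

variable {n : ℕ}

/-- The edge length. -/
def side (Q : DyadicCube n) : ℝ := 2 ^ (-Q.1)

theorem side_pos (Q : DyadicCube n) : 0 < Q.side := zpow_pos two_pos _

theorem mem_toSet {Q : DyadicCube n} {x : Space n} :
    x ∈ Q.toSet ↔ ∀ j, (Q.2 j : ℝ) * Q.side ≤ x j ∧ x j ≤ ((Q.2 j : ℝ) + 1) * Q.side :=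
  Iff.rfl

theorem center_apply (Q : DyadicCube n) (j : Fin n) :
    Q.center j = ((Q.2 j : ℝ) + 1 / 2) * Q.side := rfl

theorem mem_toSet_iff_abs {Q : DyadicCube n} {x : Space n} :
    x ∈ Q.toSet ↔ ∀ j, |x j - Q.center j| ≤ Q.side / 2 := by
  simp only [mem_toSet, center_apply, abs_le]
  refine forall_congr' fun j => ?_
  constructor <;> rintro ⟨h1, h2⟩ <;> constructor <;> linarith

theorem center_mem (Q : DyadicCube n) : Q.center ∈ Q.toSet :=
  mem_toSet_iff_abs.2 fun j => by
    rw [sub_self, abs_zero]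
    exact (half_pos Q.side_pos).le

theorem dist_center_le {Q : DyadicCube n} {x : Space n} (hx : x ∈ Q.toSet) :
    dist x Q.center ≤ √n * Q.side / 2 := by
  rw [mul_div_assoc]
  exact dist_le_sqrt_mul (by linarith [Q.side_pos]) (mem_toSet_iff_abs.1 hx)

theorem dist_le {Q : DyadicCube n} {x y : Space n} (hx : x ∈ Q.toSet) (hy : y ∈ Q.toSet) :
    dist x y ≤ √n * Q.side := by
  refine dist_le_sqrt_mul Q.side_pos.le fun j => abs_le.2 ?_
  have h1 := mem_toSet.1 hx j
  have h2 := mem_toSet.1 hy j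
  constructor <;> linarith

theorem diam_toSet (Q : DyadicCube n) : Metric.diam Q.toSet = √n * Q.side := by
  refine le_antisymm (Metric.diam_le_of_forall_dist_le (by positivity [Q.side_pos])
    fun x hx y hy => dist_le hx hy) ?_
  have hs := Q.side_pos
  -- Two opposite corners realise the diameter.
  set a : Space n := WithLp.toLp 2 fun j => (Q.2 j : ℝ) * Q.side
  set b : Space n := WithLp.toLp 2 fun j => ((Q.2 j : ℝ) + 1) * Q.side
  have ha : a ∈ Q.toSet := mem_toSet.2 fun j => ⟨le_rfl, by simp only [a]; linarith⟩
  have hb : b ∈ Q.toSet := mem_toSet.2 fun j => ⟨by simp only [b]; linarith, le_rfl⟩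
  have hbdd : Bornology.IsBounded Q.toSet :=
    Metric.isBounded_iff.2 ⟨_, fun x hx y hy => dist_le hx hy⟩
  refine le_trans (le_of_eq ?_) (Metric.dist_le_diam_of_mem hbdd hb ha)
  have h : ∀ j, dist (b j) (a j) = Q.side := fun j => by
    rw [Real.dist_eq, show b j - a j = Q.side by simp only [a, b]; ring, abs_of_pos hs]
  simp only [EuclideanSpace.dist_eq, h]
  rw [Finset.sum_const, Finset.card_univ, Fintype.card_fin, nsmul_eq_mul,
    Real.sqrt_mul (Nat.cast_nonneg n), Real.sqrt_sq hs.le]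

theorem mem_interior_toSet {Q : DyadicCube n} {x : Space n} :
    x ∈ interior Q.toSet ↔
      ∀ j, (Q.2 j : ℝ) * Q.side < x j ∧ x j < ((Q.2 j : ℝ) + 1) * Q.side := by
  let e : Space n ≃ₜ (Fin n → ℝ) := (EuclideanSpace.equiv (Fin n) ℝ).toHomeomorph
  have h : Q.toSet = e ⁻¹' Set.pi Set.univ fun j =>
      Set.Icc ((Q.2 j : ℝ) * Q.side) (((Q.2 j : ℝ) + 1) * Q.side) := by
    ext x
    simp only [mem_toSet, Set.mem_preimage, Set.mem_pi, Set.mem_univ, true_imp_iff, Set.mem_Icc]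
    rfl
  rw [h, ← e.preimage_interior, interior_pi_set Set.finite_univ]
  simp only [interior_Icc, Set.mem_preimage, Set.mem_pi, Set.mem_univ, true_imp_iff, Set.mem_Ioo]
  rfl

theorem center_mem_interior (Q : DyadicCube n) : Q.center ∈ interior Q.toSet :=
  mem_interior_toSet.2 fun j => by
    rw [center_apply]
    constructor <;> nlinarith [Q.side_pos]

theorem exists_mem_toSet (k : ℤ) (x : Space n) :
    x ∈ toSet (k, fun j => ⌊x j * 2 ^ k⌋) := by
  refine mem_toSet.2 fun j => ?_
  have h : (0 : ℝ) < 2 ^ k := zpow_pos two_pos _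
  simp only [side, zpow_neg]
  rw [← div_eq_mul_inv, ← div_eq_mul_inv, div_le_iff₀ h, le_div_iff₀ h]
  exact ⟨Int.floor_le _, (Int.lt_floor_add_one _).le⟩

theorem abs_sub_center_le_of_mem_enlarged {ε : ℚ} (hε : 0 < ε) {Q : DyadicCube n} {x : Space n}
    (hx : x ∈ Q.enlarged ε) (j : Fin n) : |x j - Q.center j| ≤ (1 + (ε : ℝ)) * (Q.side / 2) := by
  obtain ⟨z, hz, rfl⟩ := hx
  have h : (0 : ℝ) < 1 + ε := by
    have : (0 : ℝ) < ε := by exact_mod_cast hε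
    linarith
  have e : ((1 + (ε : ℝ)) • (z - Q.center) + Q.center) j - Q.center j =
      (1 + (ε : ℝ)) * (z j - Q.center j) := by
    simp
  rw [e, abs_mul, abs_of_pos h]
  exact mul_le_mul_of_nonneg_left (mem_toSet_iff_abs.1 hz j) h.le

/-! #### Ancestors -/

/-- The dyadic cube with the `2 ^ i`-fold edge length that contains the given one. -/
def ancestor (i : ℕ) (Q : DyadicCube n) : DyadicCube n := (Q.1 - i, fun j => Q.2 j / (2 ^ i : ℕ))

theorem side_ancestor (i : ℕ) (Q : DyadicCube n) : (ancestor i Q).side = 2 ^ i * Q.side := by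
  simp only [side, ancestor]
  rw [neg_sub, sub_eq_add_neg, zpow_add₀ two_ne_zero, zpow_natCast]

theorem ancestor_zero (Q : DyadicCube n) : ancestor 0 Q = Q := by
  simp [ancestor]

theorem ancestor_ancestor (i i' : ℕ) (Q : DyadicCube n) :
    ancestor i (ancestor i' Q) = ancestor (i' + i) Q := by
  refine Prod.ext ?_ (funext fun j => ?_)
  · simp only [ancestor]; push_cast; ring
  · simp only [ancestor]
    rw [Int.ediv_ediv_of_nonneg (by positivity), ← Nat.cast_mul, pow_add]

theorem ancestor_bounds (i : ℕ) (Q : DyadicCube n) (j : Fin n) :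
    ((ancestor i Q).2 j : ℝ) * 2 ^ i ≤ Q.2 j ∧
      (Q.2 j : ℝ) + 1 ≤ (((ancestor i Q).2 j : ℝ) + 1) * 2 ^ i := by
  have h : (0 : ℤ) < (2 ^ i : ℕ) := by positivity
  have h1 : Q.2 j / (2 ^ i : ℕ) * (2 ^ i : ℕ) ≤ Q.2 j := Int.ediv_mul_le _ h.ne'
  have h2 : Q.2 j + 1 ≤ (Q.2 j / (2 ^ i : ℕ) + 1) * (2 ^ i : ℕ) :=
    Int.add_one_le_of_lt (Int.lt_ediv_add_one_mul_self _ h)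
  simp only [ancestor]
  exact ⟨by exact_mod_cast h1, by exact_mod_cast h2⟩

theorem toSet_subset_ancestor (i : ℕ) (Q : DyadicCube n) : Q.toSet ⊆ (ancestor i Q).toSet := by
  intro x hx
  refine mem_toSet.2 fun j => ?_
  obtain ⟨h1, h2⟩ := mem_toSet.1 hx j
  obtain ⟨h3, h4⟩ := ancestor_bounds i Q j
  have hs := Q.side_pos
  rw [side_ancestor, ← mul_assoc, ← mul_assoc]
  exact ⟨(mul_le_mul_of_nonneg_right h3 hs.le).trans h1,
    h2.trans (mul_le_mul_of_nonneg_right h4 hs.le)⟩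

/-- Dyadic cubes whose interiors meet are nested. -/
theorem eq_ancestor_of_interior_inter {Q Q' : DyadicCube n} (h : Q.1 ≤ Q'.1)
    (hne : (interior Q.toSet ∩ interior Q'.toSet).Nonempty) :
    Q = ancestor (Q'.1 - Q.1).toNat Q' := by
  obtain ⟨x, hx, hx'⟩ := hne
  set i := (Q'.1 - Q.1).toNat with hi
  have hi' : (i : ℤ) = Q'.1 - Q.1 := Int.toNat_of_nonneg (by omega)
  have hlevel : (ancestor i Q').1 = Q.1 := by simp only [ancestor]; omega
  have hside : (ancestor i Q').side = Q.side := by simp only [side, hlevel]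
  refine Prod.ext hlevel.symm (funext fun j => ?_)
  obtain ⟨h1, h2⟩ := mem_interior_toSet.1 hx j
  obtain ⟨h3, h4⟩ := mem_interior_toSet.1
    (interior_mono (toSet_subset_ancestor i Q') hx') j
  rw [hside] at h3 h4
  -- Two grid intervals of equal length whose interiors meet have the same integer index.
  have h5 := lt_of_mul_lt_mul_right (h1.trans h4) Q.side_pos.le
  have h6 := lt_of_mul_lt_mul_right (h3.trans h2) Q.side_pos.le
  have h7 : Q.2 j < (ancestor i Q').2 j + 1 := by exact_mod_cast h5
  have h8 : (ancestor i Q').2 j < Q.2 j + 1 := by exact_mod_cast h6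
  omega

/-- Every natural number is read as the code of a cube. -/
def ofCode (n c : ℕ) : DyadicCube n :=
  (Denumerable.ofNat ℤ c.unpair.1,
    fun j => Denumerable.ofNat ℤ ((Denumerable.ofNat (List ℕ) c.unpair.2).getD j 0))

theorem ofCode_code (Q : DyadicCube n) : ofCode n Q.code = Q := by
  refine Prod.ext ?_ (funext fun j => ?_)
  · simp only [ofCode, code, Nat.unpair_pair]
    exact Denumerable.ofNat_encode _
  · simp only [ofCode, code, Nat.unpair_pair]
    rw [show ∀ l : List ℕ, Denumerable.ofNat (List ℕ) (Encodable.encode l) = l from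
      Denumerable.ofNat_encode]
    simp only [List.getD, List.getElem?_ofFn, j.2, dif_pos, Option.getD_some]
    exact Denumerable.ofNat_encode _

end DyadicCube

/-! #### Primitive recursive cubes and points -/

section PrimrecCubes

variable {n : ℕ} {α : Type*} [Primcodable α]

theorem primrec_pi_iff {σ : Type*} [Primcodable σ] {f : α → Fin n → σ} :
    Primrec f ↔ ∀ j, Primrec fun x => f x j := by
  rw [Primrec.fin_curry, ← Primrec.fin_curry₁ (f := fun j x => f x j)]
  exact ⟨Primrec₂.swap, Primrec₂.swap⟩

theorem primrec_ofCode : Primrec (DyadicCube.ofCode n) := by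
  refine ((Primrec.ofNat ℤ).comp (Primrec.fst.comp Primrec.unpair)).pair
    (primrec_pi_iff.2 fun j => (Primrec.ofNat ℤ).comp ((Primrec.list_getD 0).comp
      ((Primrec.ofNat (List ℕ)).comp (Primrec.snd.comp Primrec.unpair)) (Primrec.const (j : ℕ))))

theorem primrec_code : Primrec (DyadicCube.code : DyadicCube n → ℕ) := by
  refine Primrec₂.natPair.comp (Primrec.encode.comp Primrec.fst) (Primrec.encode.comp ?_)
  exact Primrec.list_ofFn fun j =>
    Primrec.encode.comp (primrec_pi_iff.1 Primrec.snd j)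

theorem primrec_ancestor {f : α → ℕ} {Q : α → DyadicCube n} (hf : Primrec f) (hQ : Primrec Q) :
    Primrec fun x => (Q x).ancestor (f x) :=
  (primrec_int_sub (Primrec.fst.comp hQ) (primrec_natCast_int hf)).pair
    (primrec_pi_iff.2 fun j => primrec_int_div_natCast
      (primrec_pi_iff.1 (Primrec.snd.comp hQ) j) (primrec_two_pow hf) fun _ => by positivity)

theorem primrecReal_side {Q : α → DyadicCube n} (hQ : Primrec Q) :
    PrimrecReal fun x => (Q x).side :=
  PrimrecReal.two_zpow_neg (Primrec.fst.comp hQ)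

theorem primrecReal_center {Q : α → DyadicCube n} (hQ : Primrec Q) (j : Fin n) :
    PrimrecReal fun x => (Q x).center j :=
  (((PrimrecReal.intCast (primrec_pi_iff.1 (Primrec.snd.comp hQ) j)).add
    (PrimrecReal.const (1 / 2))).mul (primrecReal_side hQ)).of_eq fun x => by
      rw [DyadicCube.center_apply]; norm_num

theorem primrecReal_ratPoint {f : α → ℕ} (hf : Primrec f) (j : Fin n) :
    PrimrecReal fun x => ratPoint n (f x) j := by
  have hk : Primrec fun x => (Denumerable.ofNat (List ℕ) (f x)).getD j 0 :=
    (Primrec.list_getD 0).comp ((Primrec.ofNat (List ℕ)).comp hf) (Primrec.const (j : ℕ))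
  have hu := Primrec.unpair.comp hk
  refine ((PrimrecReal.intCast ((Primrec.ofNat ℤ).comp (Primrec.fst.comp hu))).mul
    (PrimrecReal.inv_natCast_succ (Primrec.snd.comp hu))).of_eq fun x => ?_
  simp only [ratPoint, ratNum]
  push_cast
  rw [div_eq_mul_inv]

/-- Comparing squares, together with the sign of the radius, keeps the test within rational
arithmetic. -/
theorem primrecPred_dist_le {x y : α → Space n} {r : α → ℝ}
    (hx : ∀ j, PrimrecReal fun a => x a j) (hy : ∀ j, PrimrecReal fun a => y a j)
    (hr : PrimrecReal r) : PrimrecPred fun a => dist (x a) (y a) ≤ r a := by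
  refine (((PrimrecReal.const 0).le hr).and ((PrimrecReal.sum Finset.univ fun j =>
    ((hx j).sub (hy j)).pow_two).le hr.pow_two)).of_eq fun a => ?_
  rw [EuclideanSpace.dist_eq, Rat.cast_zero, Real.sqrt_le_iff]
  simp only [Real.dist_eq, sq_abs]

theorem primrecPred_lt_dist {x y : α → Space n} {r : α → ℝ}
    (hx : ∀ j, PrimrecReal fun a => x a j) (hy : ∀ j, PrimrecReal fun a => y a j)
    (hr : PrimrecReal r) : PrimrecPred fun a => r a < dist (x a) (y a) :=
  (primrecPred_dist_le hx hy hr).not.of_eq fun _ => not_le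

theorem primrecPred_dist_lt {x y : α → Space n} {r : α → ℝ}
    (hx : ∀ j, PrimrecReal fun a => x a j) (hy : ∀ j, PrimrecReal fun a => y a j)
    (hr : PrimrecReal r) : PrimrecPred fun a => dist (x a) (y a) < r a := by
  refine (((PrimrecReal.const 0).lt hr).and ((PrimrecReal.sum Finset.univ fun j =>
    ((hx j).sub (hy j)).pow_two).lt hr.pow_two)).of_eq fun a => ?_
  rw [Rat.cast_zero]
  have h : 0 < r a → (dist (x a) (y a) < r a ↔ ∑ j, (x a j - y a j) ^ 2 < r a ^ 2) := fun h0 => by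
    rw [EuclideanSpace.dist_eq, Real.sqrt_lt' h0]
    simp only [Real.dist_eq, sq_abs]
  exact ⟨fun h0 => (h h0.1).2 h0.2, fun h0 => ⟨dist_nonneg.trans_lt h0,
    (h (dist_nonneg.trans_lt h0)).1 h0⟩⟩

end PrimrecCubes

/-! ### Semidecidable information on the distance from a closed set -/

variable {n : ℕ}

/-- The radius of `ratBall n i`. -/
def ratRadius (i : ℕ) : ℝ := (i.unpair.2.unpair.1 : ℝ) / (i.unpair.2.unpair.2 + 1)

theorem mem_ratBall {i : ℕ} {x : Space n} :
    x ∈ ratBall n i ↔ dist x (ratPoint n i.unpair.1) < ratRadius i := Iff.rfl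

theorem primrecReal_ratRadius {α : Type*} [Primcodable α] {f : α → ℕ} (hf : Primrec f) :
    PrimrecReal fun x => ratRadius (f x) := by
  have hu := Primrec.unpair.comp (Primrec.snd.comp (Primrec.unpair.comp hf))
  exact ((PrimrecReal.natCast (Primrec.fst.comp hu)).mul
    (PrimrecReal.inv_natCast_succ (Primrec.snd.comp hu))).of_eq fun x => by
      rw [ratRadius, div_eq_mul_inv]

/-- Among the first `t` entries of the positive information in `p` there is a ball that lies in the
ball with center `c` and radius `r`. -/
def Meets (p : ℕ → ℕ) (t : ℕ) (c : Space n) (r : ℝ) : Prop :=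
  ∃ i < t, p (2 * i + 1) ≠ 0 ∧
    dist (ratPoint n (p (2 * i + 1) - 1).unpair.1) c ≤ r - ratRadius (p (2 * i + 1) - 1)

theorem Meets.mono {p : ℕ → ℕ} {t t' : ℕ} {c : Space n} {r : ℝ} (h : Meets p t c r)
    (ht : t ≤ t') : Meets p t' c r :=
  h.imp fun _ hi => ⟨hi.1.trans_le ht, hi.2⟩

theorem Meets.exists_dist_lt {p : ℕ → ℕ} {F : ClosedSet n} (hp : (totalRep n).IsName p F) {t : ℕ}
    {c : Space n} {r : ℝ} (h : Meets p t c r) : ∃ y ∈ F, dist y c < r := by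
  obtain ⟨i, -, h0, hi⟩ := h
  obtain ⟨y, hy, hyF⟩ := (hp.2 (p (2 * i + 1) - 1)).1 ⟨i, by simp only [right]; omega⟩
  have := mem_ratBall.1 hy
  exact ⟨y, hyF, by linarith [dist_triangle y (ratPoint n (p (2 * i + 1) - 1).unpair.1) c]⟩

/-- With rational centre and radius, the ball is itself a member of the enumeration, so positive
information lists it as soon as it meets F. -/
theorem exists_meets {p : ℕ → ℕ} {F : ClosedSet n} (hp : (totalRep n).IsName p F)
    {v : Fin n → ℚ} {q : ℚ} {c : Space n} {r : ℝ} (hc : ∀ j, c j = v j) (hr : r = q)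
    {y : Space n} (hy : y ∈ F) (hyc : dist y c < r) : ∃ t, Meets p t c r := by
  obtain ⟨k, hk⟩ := exists_ratPoint n v
  have hck : ratPoint n k = c := by
    rw [hk]
    ext j
    exact (hc j).symm
  have hq : 0 < q := by
    have : (0 : ℝ) < q := hr ▸ dist_nonneg.trans_lt hyc
    exact_mod_cast this
  set b := Nat.pair k (Nat.pair q.num.toNat (q.den - 1)) with hb
  have hb1 : b.unpair.1 = k := by rw [hb, Nat.unpair_pair]
  have hb2 : ratRadius b = r := by
    have h1 : ((q.den - 1 : ℕ) : ℝ) + 1 = q.den := by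
      exact_mod_cast Nat.sub_add_cancel q.den_pos
    have h2 : ((q.num.toNat : ℕ) : ℝ) = q.num := by
      exact_mod_cast congrArg (Int.cast : ℤ → ℝ) (Int.toNat_of_nonneg (Rat.num_pos.2 hq).le)
    rw [ratRadius, hb, Nat.unpair_pair]
    simp only [Nat.unpair_pair]
    rw [h1, h2, hr]
    exact_mod_cast Rat.num_div_den q
  obtain ⟨i, hi⟩ := (hp.2 b).2 ⟨y, mem_ratBall.2 (by rwa [hb1, hb2, hck]), hy⟩
  have hi' : p (2 * i + 1) = b + 1 := hi
  refine ⟨i + 1, i, Nat.lt_succ_self i, ?_, ?_⟩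
  · omega
  · rw [hi', Nat.add_sub_cancel, hb1, hb2, hck, dist_self, sub_self]

/-- A test at stage t sees only the first 2t entries of the name, so it can be evaluated on a finite
prefix extended by zeros. -/
theorem meets_congr {p p' : ℕ → ℕ} {t : ℕ} (h : ∀ i < 2 * t, p i = p' i) (c : Space n) (r : ℝ) :
    Meets p t c r ↔ Meets p' t c r :=
  exists_congr fun i => and_congr_right fun hi => by rw [h (2 * i + 1) (by omega)]

/-- The points of a cubic grid with `b ^ n` points and mesh `h`; the coordinates are numbered by
the digits of `e` in base `b`. -/
def gridPoint (c : Space n) (h : ℝ) (m b e : ℕ) : Space n :=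
  WithLp.toLp 2 fun j => c j + (((e / b ^ (j : ℕ) % b : ℕ) : ℝ) - m) * h

theorem exists_digits {b : ℕ} {d : Fin n → ℕ} (hd : ∀ j, d j < b) :
    ∃ e < b ^ n, ∀ j : Fin n, e / b ^ (j : ℕ) % b = d j := by
  refine ⟨finFunctionFinEquiv fun j => ⟨d j, hd j⟩, Fin.is_lt _, fun j => ?_⟩
  have h := congrFun (finFunctionFinEquiv.symm_apply_apply fun j => (⟨d j, hd j⟩ : Fin b)) j
  simpa [finFunctionFinEquiv] using congrArg Fin.val h

theorem exists_gridPoint_dist_le {c y : Space n} {h : ℝ} {m : ℕ} (hh : 0 < h)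
    (hy : dist y c ≤ m * h) :
    ∃ e < (2 * m + 1) ^ n, dist y (gridPoint c h m (2 * m + 1) e) ≤ n * h := by
  have hd : ∀ j, |(y j - c j) / h| ≤ m := fun j => by
    rw [abs_div, abs_of_pos hh, div_le_iff₀ hh]
    exact (abs_sub_apply_le_dist y c j).trans hy
  have hfl : ∀ j, -(m : ℤ) ≤ ⌊(y j - c j) / h⌋ ∧ ⌊(y j - c j) / h⌋ ≤ m := fun j => by
    have := abs_le.1 (hd j)
    refine ⟨Int.le_floor.2 (by push_cast; exact this.1), ?_⟩
    have := (Int.floor_le ((y j - c j) / h)).trans this.2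
    exact Int.cast_le.1 (this.trans_eq (Int.cast_natCast m).symm)
  obtain ⟨e, he, hed⟩ := exists_digits (n := n) (b := 2 * m + 1)
    (d := fun j => (⌊(y j - c j) / h⌋ + m).toNat) fun j => by have := hfl j; omega
  -- The grid error √n h is coarsened to n h to keep the margin in `Avoids` rational.
  have hn : √(n : ℝ) ≤ n := by
    rw [Real.sqrt_le_left (Nat.cast_nonneg n)]
    exact_mod_cast Nat.le_self_pow two_ne_zero n
  refine ⟨e, he, (dist_le_sqrt_mul hh.le fun j => ?_).trans (mul_le_mul_of_nonneg_right hn hh.le)⟩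
  have h1 : (((⌊(y j - c j) / h⌋ + m).toNat : ℕ) : ℝ) = ⌊(y j - c j) / h⌋ + m := by
    have := Int.toNat_of_nonneg (show 0 ≤ ⌊(y j - c j) / h⌋ + m by have := hfl j; omega)
    exact_mod_cast congrArg (Int.cast : ℤ → ℝ) this
  have h2 : y j - gridPoint c h m (2 * m + 1) e j = Int.fract ((y j - c j) / h) * h := by
    simp only [gridPoint]
    rw [hed j, h1, Int.fract]
    field_simp
    ring
  rw [h2, abs_of_nonneg (mul_nonneg (Int.fract_nonneg _) hh.le)]
  exact mul_le_of_le_one_left hh.le (Int.fract_lt_one _).le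

/-- The first `t` balls of the negative information in `p` cover the closed ball with center `c`
and radius `r`, as is seen from a grid of mesh `r / (t + 1)`. -/
def Avoids (p : ℕ → ℕ) (t : ℕ) (c : Space n) (r : ℝ) : Prop :=
  ∀ e < (2 * (t + 1) + 1) ^ n,
    r + n * (r * ((t : ℝ) + 1)⁻¹) <
        dist (gridPoint c (r * ((t : ℝ) + 1)⁻¹) (t + 1) (2 * (t + 1) + 1) e) c ∨
      ∃ i < t, dist (gridPoint c (r * ((t : ℝ) + 1)⁻¹) (t + 1) (2 * (t + 1) + 1) e)
        (ratPoint n (p (2 * i)).unpair.1) < ratRadius (p (2 * i)) - n * (r * ((t : ℝ) + 1)⁻¹)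

/-- A point of F in the closed ball would be within n h of a grid point (h the mesh). That grid
point is at most r + n h from c, so it lies in a listed ball with margin n h, and the listed ball
would contain the point of F. -/
theorem Avoids.lt_dist {p : ℕ → ℕ} {F : ClosedSet n} (hp : (totalRep n).IsName p F) {t : ℕ}
    {c : Space n} {r : ℝ} (hr : 0 < r) (h : Avoids p t c r) {y : Space n} (hy : y ∈ F) :
    r < dist y c := by
  by_contra! hcon
  set m := r * ((t : ℝ) + 1)⁻¹ with hm
  have hmpos : 0 < m := by positivity
  have hrm : ((t + 1 : ℕ) : ℝ) * m = r := by
    rw [hm]; push_cast; field_simp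
  obtain ⟨e, he, hye⟩ := exists_gridPoint_dist_le (m := t + 1) hmpos (hcon.trans hrm.ge)
  rcases h e he with h1 | ⟨i, -, h1⟩
  · rw [← hm] at h1
    linarith [dist_triangle_left (gridPoint c m (t + 1) (2 * (t + 1) + 1) e) c y]
  · rw [← hm] at h1
    have h2 : y ∈ ratBall n (p (2 * i)) := by
      rw [mem_ratBall]
      linarith [dist_triangle y (gridPoint c m (t + 1) (2 * (t + 1) + 1) e)
        (ratPoint n (p (2 * i)).unpair.1)]
    have h3 : y ∈ (F : Set (Space n)) := hy
    rw [show (F : Set (Space n)) = _ from hp.1] at h3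
    exact h3 (Set.mem_biUnion ⟨i, rfl⟩ h2)

/-- Compactness of the slightly larger closed ball of radius r': the listed balls, shrunk by the
margin of stage t, form an increasing open cover, so one stage suffices. -/
theorem exists_avoids {p : ℕ → ℕ} {F : ClosedSet n} (hp : (totalRep n).IsName p F)
    {c : Space n} {r r' : ℝ} (hr : 0 < r) (hrr' : r < r') (hF : ∀ y ∈ F, r' < dist y c) :
    ∃ t, Avoids p t c r := by
  let V : ℕ → Set (Space n) := fun t => ⋃ i < t, {y | dist y (ratPoint n (p (2 * i)).unpair.1) <
    ratRadius (p (2 * i)) - n * (r * ((t : ℝ) + 1)⁻¹)}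
  have hVmono : Monotone V := by
    intro s t hst y hy
    simp only [V, Set.mem_iUnion, exists_prop, Set.mem_ofPred_eq] at hy ⊢
    obtain ⟨i, hi, hyi⟩ := hy
    refine ⟨i, hi.trans_le hst, hyi.trans_le ?_⟩
    have : n * (r * ((t : ℝ) + 1)⁻¹) ≤ n * (r * ((s : ℝ) + 1)⁻¹) := by
      gcongr
    linarith
  have hVopen : ∀ t, IsOpen (V t) := fun t =>
    isOpen_biUnion fun i _ => isOpen_lt (continuous_id.dist continuous_const) continuous_const
  have hlim : Filter.Tendsto (fun t : ℕ => n * (r * ((t : ℝ) + 1)⁻¹)) Filter.atTop (𝓝 0) := by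
    have := (tendsto_one_div_add_atTop_nhds_zero_nat (𝕜 := ℝ)).const_mul (n * r)
    simpa [mul_assoc] using this
  have hcover : Metric.closedBall c r' ⊆ ⋃ t, V t := by
    intro y hy
    have hyF : y ∉ (F : Set (Space n)) := fun h => absurd (hF y h) (not_lt.2 hy)
    rw [show (F : Set (Space n)) = _ from hp.1, Set.mem_compl_iff, not_not] at hyF
    simp only [Set.mem_iUnion, exists_prop] at hyF
    obtain ⟨_, ⟨i, rfl⟩, hi⟩ := hyF
    have hi' : 0 < ratRadius (p (2 * i)) - dist y (ratPoint n (p (2 * i)).unpair.1) :=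
      sub_pos.2 hi
    obtain ⟨t, ht, hit⟩ := ((hlim.eventually_lt_const hi').and
      (Filter.eventually_gt_atTop i)).exists
    refine Set.mem_iUnion.2 ⟨t, Set.mem_biUnion hit ?_⟩
    simp only [Set.mem_ofPred_eq]
    linarith
  obtain ⟨t₀, ht₀⟩ := (isCompact_closedBall c r').elim_directed_cover V hVopen hcover
    hVmono.directed_le
  -- Once the margin is below r' - r, every grid point not dismissed as too distant lies in the
  -- compact ball.
  obtain ⟨t, ht, htt⟩ := ((hlim.eventually_lt_const (sub_pos.2 hrr')).and
    (Filter.eventually_ge_atTop t₀)).exists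
  refine ⟨t, fun e _ => ?_⟩
  rw [or_iff_not_imp_left, not_lt]
  intro h
  have h1 := hVmono htt (ht₀ (Metric.mem_closedBall.2 (h.trans (by linarith))))
  simp only [V, Set.mem_iUnion, exists_prop, Set.mem_ofPred_eq] at h1
  exact h1

theorem avoids_congr {p p' : ℕ → ℕ} {t : ℕ} (h : ∀ i < 2 * t, p i = p' i) (c : Space n) (r : ℝ) :
    Avoids p t c r ↔ Avoids p' t c r :=
  forall₂_congr fun e _ => or_congr_right <| exists_congr fun i => and_congr_right fun hi => by
    rw [h (2 * i) (by omega)]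

/-! ### Primitive recursiveness of the distance tests -/

section Primrec

variable {α : Type*} [Primcodable α] {L : α → List ℕ} {t : α → ℕ} {c : α → Space n} {r : α → ℝ}

theorem primrecPred_meets (hL : Primrec L) (ht : Primrec t)
    (hc : ∀ j, PrimrecReal fun x => c x j) (hr : PrimrecReal r) :
    PrimrecPred fun x => Meets (fun i => (L x).getD i 0) (t x) (c x) (r x) := by
  refine primrecPred_exists_lt ?_ ht
  have hv : Primrec fun z : α × ℕ => (L z.1).getD (2 * z.2 + 1) 0 :=
    (Primrec.list_getD 0).comp (hL.comp Primrec.fst) (Primrec.nat_double_succ.comp Primrec.snd)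
  have hv' : Primrec fun z : α × ℕ => (L z.1).getD (2 * z.2 + 1) 0 - 1 :=
    Primrec.nat_sub.comp hv (Primrec.const 1)
  exact (Primrec.eq.comp hv (Primrec.const 0)).not.and (primrecPred_dist_le
    (primrecReal_ratPoint (Primrec.fst.comp (Primrec.unpair.comp hv')))
    (fun j => (hc j).comp Primrec.fst)
    ((hr.comp Primrec.fst).sub (primrecReal_ratRadius hv')))

theorem primrecReal_gridPoint {h : α → ℝ} {m b e : α → ℕ} (hc : ∀ j, PrimrecReal fun x => c x j)
    (hh : PrimrecReal h) (hm : Primrec m) (hb : Primrec b) (he : Primrec e) (j : Fin n) :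
    PrimrecReal fun x => gridPoint (c x) (h x) (m x) (b x) (e x) j :=
  (hc j).add (((PrimrecReal.natCast (Primrec.nat_mod.comp (Primrec.nat_div.comp he
    (primrec_nat_pow hb (Primrec.const (j : ℕ)))) hb)).sub (PrimrecReal.natCast hm)).mul hh)

theorem primrecPred_avoids (hL : Primrec L) (ht : Primrec t)
    (hc : ∀ j, PrimrecReal fun x => c x j) (hr : PrimrecReal r) :
    PrimrecPred fun x => Avoids (fun i => (L x).getD i 0) (t x) (c x) (r x) := by
  have hb : Primrec fun x => 2 * (t x + 1) + 1 :=
    Primrec.nat_double_succ.comp (Primrec.succ.comp ht)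
  have hh : PrimrecReal fun x => r x * ((t x : ℝ) + 1)⁻¹ :=
    hr.mul (PrimrecReal.inv_natCast_succ ht)
  have hnh : PrimrecReal fun x => n * (r x * ((t x : ℝ) + 1)⁻¹) :=
    (PrimrecReal.natCast (Primrec.const n)).mul hh
  have hg : ∀ j, PrimrecReal fun z : α × ℕ => gridPoint (c z.1) (r z.1 * ((t z.1 : ℝ) + 1)⁻¹)
      (t z.1 + 1) (2 * (t z.1 + 1) + 1) z.2 j :=
    primrecReal_gridPoint (fun j => (hc j).comp Primrec.fst) (hh.comp Primrec.fst)
      (Primrec.succ.comp (ht.comp Primrec.fst)) (hb.comp Primrec.fst) Primrec.snd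
  refine primrecPred_forall_lt (PrimrecPred.or ?_ ?_) (primrec_nat_pow hb (Primrec.const n))
  · exact primrecPred_lt_dist hg (fun j => (hc j).comp Primrec.fst)
      ((hr.add hnh).comp Primrec.fst)
  · refine primrecPred_exists_lt ?_ (ht.comp Primrec.fst)
    have hv : Primrec fun z : (α × ℕ) × ℕ => (L z.1.1).getD (2 * z.2) 0 :=
      (Primrec.list_getD 0).comp (hL.comp (Primrec.fst.comp Primrec.fst))
        (Primrec.nat_double.comp Primrec.snd)
    exact primrecPred_dist_lt (fun j => (hg j).comp Primrec.fst)
      (primrecReal_ratPoint (Primrec.fst.comp (Primrec.unpair.comp hv)))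
      ((primrecReal_ratRadius hv).sub (hnh.comp (Primrec.fst.comp Primrec.fst)))

end Primrec

/-! ### A computable Whitney decomposition -/

/-- A natural number between `√n` and `2 * √n`. -/
def sqrtBound (n : ℕ) : ℕ := Nat.sqrt n + 1

theorem sqrt_lt_sqrtBound (n : ℕ) : √(n : ℝ) < sqrtBound n := by
  exact_mod_cast Real.real_sqrt_lt_nat_sqrt_succ

theorem one_le_sqrt {n : ℕ} (hn : 1 ≤ n) : 1 ≤ √(n : ℝ) :=
  Real.one_le_sqrt.2 (by exact_mod_cast hn)

theorem sqrtBound_le {n : ℕ} (hn : 1 ≤ n) : (sqrtBound n : ℝ) ≤ 2 * √(n : ℝ) := by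
  have h1 : (Nat.sqrt n : ℝ) ≤ √(n : ℝ) := Real.nat_sqrt_le_real_sqrt
  have h2 := one_le_sqrt hn
  rw [sqrtBound]
  push_cast
  linarith

/-- The factor exceeds √n so that accepted cubes are farther from F than half their diameter. The
extra 1/4 in `Near` makes the two conditions overlap, so that one of them is always confirmed. -/
def Far (p : ℕ → ℕ) (t : ℕ) (Q : DyadicCube n) : Prop :=
  Avoids p t Q.center (sqrtBound n * Q.side)

def Near (p : ℕ → ℕ) (t : ℕ) (Q : DyadicCube n) : Prop :=
  Meets p t Q.center ((sqrtBound n + 1 / 4) * Q.side)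

/-- The cube is found to be far from the set before it is found to be near to it. -/
def Accepts (p : ℕ → ℕ) (T : ℕ) (Q : DyadicCube n) : Prop :=
  ∃ t < T, Far p t Q ∧ ∀ s < t, ¬Near p s Q

/-- The cube is found to be near to the set before it is found to be far from it. -/
def Rejects (p : ℕ → ℕ) (T : ℕ) (Q : DyadicCube n) : Prop :=
  ∃ t < T, Near p t Q ∧ ∀ s < t + 1, ¬Far p s Q

/-- The maximal accepted cubes. -/
def whitneyFamily (n : ℕ) (p : ℕ → ℕ) : Set (DyadicCube n) :=
  {Q | (∃ T, Accepts p T Q) ∧ ∀ i T, ¬Accepts p T (Q.ancestor (i + 1))}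

/-! ### Acceptance and rejection of cubes -/

section Tests

variable {p : ℕ → ℕ} {F : ClosedSet n} {Q : DyadicCube n} {T T' : ℕ}

theorem Accepts.mono (h : Accepts p T Q) (hT : T ≤ T') : Accepts p T' Q :=
  h.imp fun _ ht => ⟨ht.1.trans_le hT, ht.2⟩

theorem Rejects.mono (h : Rejects p T Q) (hT : T ≤ T') : Rejects p T' Q :=
  h.imp fun _ ht => ⟨ht.1.trans_le hT, ht.2⟩

theorem Rejects.not_accepts (h : Rejects p T Q) : ¬Accepts p T' Q := by
  rintro ⟨s, -, hs, hs'⟩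
  obtain ⟨t, -, ht, ht'⟩ := h
  rcases lt_or_ge t s with hts | hts
  · exact hs' t hts ht
  · exact ht' s (Nat.lt_succ_of_le hts) hs

theorem exists_rat_center (Q : DyadicCube n) : ∃ v : Fin n → ℚ, ∀ j, Q.center j = v j :=
  ⟨fun j => ((Q.2 j : ℚ) + 1 / 2) * 2 ^ (-Q.1), fun j => by
    rw [DyadicCube.center_apply, DyadicCube.side]; push_cast; rfl⟩

theorem exists_meets_center (hp : (totalRep n).IsName p F) (Q : DyadicCube n) (q : ℚ)
    {y : Space n} (hy : y ∈ F) (h : dist y Q.center < q * Q.side) :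
    ∃ t, Meets p t Q.center (q * Q.side) := by
  obtain ⟨v, hv⟩ := exists_rat_center Q
  exact exists_meets hp hv (q := q * 2 ^ (-Q.1)) (by rw [DyadicCube.side]; push_cast; rfl) hy h

theorem accepts_or_rejects (hp : (totalRep n).IsName p F) (Q : DyadicCube n) :
    ∃ T, Accepts p T Q ∨ Rejects p T Q := by
  classical
  have hs := Q.side_pos
  have hρ : (0 : ℝ) < sqrtBound n := (Real.sqrt_nonneg _).trans_lt (sqrt_lt_sqrtBound n)
  have h : ∃ t, Far p t Q ∨ Near p t Q := by
    -- The threshold 1/8 lies strictly between the two test radii, leaving `exists_avoids` its room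
    -- and `Near` its strict inequality.
    by_cases hF : ∀ y ∈ F, (sqrtBound n + 1 / 8 : ℝ) * Q.side < dist y Q.center
    · obtain ⟨t, ht⟩ := exists_avoids hp (mul_pos hρ hs)
        (show sqrtBound n * Q.side < (sqrtBound n + 1 / 8 : ℝ) * Q.side by gcongr; linarith) hF
      exact ⟨t, Or.inl ht⟩
    · push Not at hF
      obtain ⟨y, hy, hyQ⟩ := hF
      obtain ⟨t, ht⟩ := exists_meets_center hp Q (sqrtBound n + 1 / 4) hy
        (hyQ.trans_lt (by push_cast; gcongr; norm_num))
      push_cast at ht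
      exact ⟨t, Or.inr ht⟩
  set t := Nat.find h with ht
  have hmin : ∀ s < t, ¬Far p s Q ∧ ¬Near p s Q := fun s hs => not_or.1 (Nat.find_min h hs)
  refine ⟨t + 1, ?_⟩
  -- If both tests first succeed at the same stage, acceptance wins; hence the bound `t + 1` in
  -- `Rejects`.
  by_cases hfar : Far p t Q
  · exact Or.inl ⟨t, Nat.lt_succ_self t, hfar, fun s hs => (hmin s hs).2⟩
  · refine Or.inr ⟨t, Nat.lt_succ_self t, (Nat.find_spec h).resolve_left hfar, fun s hs => ?_⟩
    rcases Nat.lt_succ_iff_lt_or_eq.1 hs with hs | rfl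
    · exact (hmin s hs).1
    · exact hfar

theorem Accepts.lt_dist (hp : (totalRep n).IsName p F) (h : Accepts p T Q) {y : Space n}
    (hy : y ∈ F) : sqrtBound n * Q.side < dist y Q.center := by
  obtain ⟨t, -, ht, -⟩ := h
  exact Avoids.lt_dist hp (mul_pos ((Real.sqrt_nonneg _).trans_lt (sqrt_lt_sqrtBound n))
    Q.side_pos) ht hy

theorem Rejects.exists_dist_lt (hp : (totalRep n).IsName p F) (h : Rejects p T Q) :
    ∃ y ∈ F, dist y Q.center < (sqrtBound n + 1 / 4) * Q.side := by
  obtain ⟨t, -, ht, -⟩ := h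
  exact Meets.exists_dist_lt hp ht

theorem dist_center_ancestor_le {x : Space n} (hx : x ∈ Q.toSet) (i : ℕ) :
    dist x (Q.ancestor i).center ≤ √n * (2 ^ i * Q.side) / 2 := by
  rw [← DyadicCube.side_ancestor]
  exact DyadicCube.dist_center_le (Q.toSet_subset_ancestor i hx)

theorem dist_center_parent_le (Q : DyadicCube n) :
    dist Q.center (Q.ancestor 1).center ≤ √n * (Q.side / 2) := by
  refine dist_le_sqrt_mul (half_pos Q.side_pos).le fun j => ?_
  obtain ⟨h1, h2⟩ := DyadicCube.ancestor_bounds 1 Q j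
  have hs := Q.side_pos
  rw [DyadicCube.center_apply, DyadicCube.center_apply, DyadicCube.side_ancestor, abs_le]
  constructor <;> nlinarith

/-- With S the side of the ancestor, y is at most S/2 + √n S/2 ≤ √n S from its centre, less than
acceptance requires. -/
theorem not_accepts_ancestor (hn : 1 ≤ n) (hp : (totalRep n).IsName p F) {x y : Space n}
    (hx : x ∈ Q.toSet) (hy : y ∈ F) {i : ℕ} (h : dist y x ≤ 2 ^ i * Q.side / 2) :
    ¬Accepts p T (Q.ancestor i) := by
  intro hacc
  have h1 := hacc.lt_dist hp hy
  have h2 := dist_center_ancestor_le hx i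
  have h3 := dist_triangle y x (Q.ancestor i).center
  rw [DyadicCube.side_ancestor] at h1
  have h4 : 0 < 2 ^ i * Q.side := mul_pos (by positivity) Q.side_pos
  have h5 := one_le_sqrt hn
  have h6 := sqrt_lt_sqrtBound n
  nlinarith

end Tests

theorem setDist_toSet_bounds (hn : 1 ≤ n) {F : ClosedSet n} (hF : (F : Set (Space n)).Nonempty)
    {p : ℕ → ℕ} (hp : (totalRep n).IsName p F) {Q : DyadicCube n} (hQ : Q ∈ whitneyFamily n p) :
    1 / 2 * Metric.diam Q.toSet < setDist Q.toSet F ∧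
      setDist Q.toSet F < 5 * Metric.diam Q.toSet := by
  obtain ⟨⟨T, hT⟩, hanc⟩ := hQ
  have hs := Q.side_pos
  have h1 := sqrt_lt_sqrtBound n
  have h2 := one_le_sqrt hn
  have h3 := sqrtBound_le hn
  rw [DyadicCube.diam_toSet]
  constructor
  · refine lt_of_lt_of_le ?_ (le_setDist ⟨_, Q.center_mem⟩ hF
      (r := sqrtBound n * Q.side - √n * Q.side / 2) fun x hx y hy => ?_)
    · nlinarith
    · have h4 := hT.lt_dist hp hy
      have h5 := DyadicCube.dist_center_le hx
      linarith [dist_triangle y x Q.center, dist_comm x y]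
  · obtain ⟨T', hT'⟩ := accepts_or_rejects hp (Q.ancestor 1)
    obtain ⟨y, hy, hyQ⟩ := (hT'.resolve_left (hanc 0 T')).exists_dist_lt hp
    have h4 := dist_center_parent_le Q
    have h5 := setDist_le_dist Q.center_mem (B := F) hy
    rw [DyadicCube.side_ancestor] at hyQ
    have h6 := dist_triangle_right Q.center y (Q.ancestor 1).center
    nlinarith

theorem exists_mem_whitneyFamily (hn : 1 ≤ n) {F : ClosedSet n}
    (hF : (F : Set (Space n)).Nonempty) {p : ℕ → ℕ} (hp : (totalRep n).IsName p F) {x : Space n}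
    (hx : x ∉ F) : ∃ Q ∈ whitneyFamily n p, x ∈ Q.toSet := by
  classical
  obtain ⟨r, hr, hball⟩ := Metric.isOpen_iff.1 F.isClosed.isOpen_compl x hx
  -- The side is chosen so small that rejection would put a point of F into the ball around x that
  -- avoids F.
  have hρ : (0 : ℝ) < sqrtBound n + 1 / 4 + √n := by positivity
  obtain ⟨k, hk⟩ := exists_pow_lt_of_lt_one (div_pos hr hρ) (show (2⁻¹ : ℝ) < 1 by norm_num)
  set Q : DyadicCube n := ((k : ℤ), fun j => ⌊x j * 2 ^ (k : ℤ)⌋) with hQ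
  have hxQ : x ∈ Q.toSet := DyadicCube.exists_mem_toSet k x
  have hside : Q.side = 2⁻¹ ^ k := by
    rw [DyadicCube.side, hQ, zpow_neg, zpow_natCast, inv_pow]
  have hs := Q.side_pos
  have hacc : ∃ T, Accepts p T (Q.ancestor 0) := by
    rw [DyadicCube.ancestor_zero]
    obtain ⟨T, hT⟩ := accepts_or_rejects hp Q
    refine ⟨T, hT.resolve_right fun hrej => ?_⟩
    obtain ⟨y, hy, hyQ⟩ := hrej.exists_dist_lt hp
    rw [lt_div_iff₀ hρ, ← hside] at hk
    have h1 := DyadicCube.dist_center_le hxQ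
    have h2 := dist_triangle_right y x Q.center
    refine hball (Metric.mem_ball.2 ?_) hy
    nlinarith [Real.sqrt_nonneg (n : ℝ)]
  have hfin : ∃ m, ∀ i ≥ m, ∀ T, ¬Accepts p T (Q.ancestor i) := by
    obtain ⟨y, hy⟩ := hF
    obtain ⟨m, hm⟩ := pow_unbounded_of_one_lt (dist y x * 2 / Q.side) (one_lt_two (α := ℝ))
    refine ⟨m, fun i hi T => not_accepts_ancestor hn hp hxQ hy ?_⟩
    rw [div_lt_iff₀ hs] at hm
    have : (2 : ℝ) ^ m ≤ 2 ^ i := pow_le_pow_right₀ one_le_two hi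
    nlinarith
  -- The ancestor just before the least index beyond which nothing is accepted is the maximal
  -- accepted cube; index 0 is excluded as Q is accepted.
  have hpos : Nat.find hfin ≠ 0 := fun h0 => by
    obtain ⟨T, hT⟩ := hacc
    exact Nat.find_spec hfin 0 (by omega) T hT
  obtain ⟨m, hm⟩ := Nat.exists_eq_succ_of_ne_zero hpos
  have hmax := Nat.find_spec hfin
  have hmin := Nat.find_min hfin (show m < Nat.find hfin by omega)
  push Not at hmin
  obtain ⟨i, hi, T, hT⟩ := hmin
  have him : i = m := by
    by_contra hne
    exact hmax i (by omega) T hT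
  subst him
  refine ⟨Q.ancestor i, ⟨⟨T, hT⟩, fun l T' => ?_⟩, Q.toSet_subset_ancestor i hxQ⟩
  rw [DyadicCube.ancestor_ancestor]
  exact hmax _ (by omega) T'

theorem whitneyFamily_mem_CUBE (hn : 1 ≤ n) {F : ClosedSet n} (hF : (F : Set (Space n)).Nonempty)
    {p : ℕ → ℕ} (hp : (totalRep n).IsName p F) : whitneyFamily n p ∈ CUBE n F := by
  refine ⟨hF, ?_, ?_, fun Q hQ => setDist_toSet_bounds hn hF hp hQ⟩
  · ext x
    simp only [Set.mem_iUnion, exists_prop, Set.mem_compl_iff]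
    refine ⟨?_, fun hx => exists_mem_whitneyFamily hn hF hp hx⟩
    rintro ⟨Q, ⟨⟨T, hT⟩, -⟩, hx⟩ hxF
    have h1 := hT.lt_dist hp hxF
    have h2 := DyadicCube.dist_center_le hx
    nlinarith [Q.side_pos, sqrt_lt_sqrtBound n, one_le_sqrt hn]
  · intro Q hQ Q' hQ' hne
    by_contra hcon
    have key : ∀ {Q Q' : DyadicCube n}, Q ∈ whitneyFamily n p → Q' ∈ whitneyFamily n p →
        Q.1 ≤ Q'.1 → (interior Q.toSet ∩ interior Q'.toSet).Nonempty → Q = Q' := by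
      intro Q Q' hQ hQ' hle hmeet
      have h := DyadicCube.eq_ancestor_of_interior_inter hle hmeet
      rcases hi : (Q'.1 - Q.1).toNat with _ | i
      · rw [h, hi, DyadicCube.ancestor_zero]
      · obtain ⟨T, hT⟩ := hQ.1
        rw [h, hi] at hT
        exact absurd hT (hQ'.2 i T)
    have hmeet := Set.nonempty_iff_ne_empty.2 hcon
    rcases le_total Q.1 Q'.1 with hle | hle
    · exact hne (key hQ hQ' hle hmeet)
    · exact hne (key hQ' hQ hle (Set.inter_comm _ _ ▸ hmeet)).symm

/-! #### Deciding membership -/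

/-- A finite certificate of maximality: the point of F found at scale N rules out all ancestors
beyond the N-th, and the first N are rejected one by one. -/
def Selects (p : ℕ → ℕ) (T : ℕ) (Q : DyadicCube n) : Prop :=
  Accepts p T Q ∧ ∃ N < T, Meets p T Q.center (2 ^ N * (1 / 2 * Q.side)) ∧
    ∀ i < N, Rejects p T (Q.ancestor (i + 1))

def Discards (p : ℕ → ℕ) (T : ℕ) (Q : DyadicCube n) : Prop :=
  Rejects p T Q ∨ ∃ i < T, Accepts p T (Q.ancestor (i + 1))

section Decide

variable {p : ℕ → ℕ} {F : ClosedSet n} {Q : DyadicCube n} {T : ℕ}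

theorem Selects.mem (hn : 1 ≤ n) (hp : (totalRep n).IsName p F) (h : Selects p T Q) :
    Q ∈ whitneyFamily n p := by
  obtain ⟨hacc, N, -, hmeets, hrej⟩ := h
  refine ⟨⟨T, hacc⟩, fun i T' => ?_⟩
  rcases lt_or_ge i N with hi | hi
  · exact (hrej i hi).not_accepts
  · obtain ⟨y, hy, hyQ⟩ := hmeets.exists_dist_lt hp
    refine not_accepts_ancestor hn hp Q.center_mem hy (hyQ.le.trans ?_)
    have : (2 : ℝ) ^ N ≤ 2 ^ (i + 1) := pow_le_pow_right₀ one_le_two (by omega)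
    nlinarith [Q.side_pos]

theorem Discards.notMem (h : Discards p T Q) : Q ∉ whitneyFamily n p := by
  rintro ⟨⟨T', hT'⟩, hanc⟩
  rcases h with h | ⟨i, -, hi⟩
  · exact h.not_accepts hT'
  · exact hanc i T hi

theorem exists_selects (hF : (F : Set (Space n)).Nonempty) (hp : (totalRep n).IsName p F)
    (hQ : Q ∈ whitneyFamily n p) : ∃ T, Selects p T Q := by
  obtain ⟨⟨T₁, h₁⟩, hanc⟩ := hQ
  obtain ⟨y, hy⟩ := hF
  have hs := Q.side_pos
  obtain ⟨N, hN⟩ := pow_unbounded_of_one_lt (dist y Q.center * 2 / Q.side) (one_lt_two (α := ℝ))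
  rw [div_lt_iff₀ hs] at hN
  obtain ⟨T₂, h₂⟩ := exists_meets_center hp Q (2 ^ N * (1 / 2)) hy (by push_cast; linarith)
  have hrej : ∀ i, ∃ T, Rejects p T (Q.ancestor (i + 1)) := fun i =>
    (accepts_or_rejects hp (Q.ancestor (i + 1))).imp fun T hT => hT.resolve_left (hanc i T)
  choose S hS using hrej
  have hSle : ∀ i < N, S i ≤ ∑ i ∈ Finset.range N, S i := fun i hi =>
    Finset.single_le_sum (fun _ _ => Nat.zero_le _) (Finset.mem_range.2 hi)
  push_cast at h₂
  rw [mul_assoc] at h₂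
  refine ⟨T₁ + T₂ + (N + 1) + ∑ i ∈ Finset.range N, S i, h₁.mono (by omega), N, by omega,
    h₂.mono (by omega), fun i hi => (hS i).mono ?_⟩
  have := hSle i hi
  omega

theorem exists_discards (hp : (totalRep n).IsName p F) (hQ : Q ∉ whitneyFamily n p) :
    ∃ T, Discards p T Q := by
  obtain ⟨T, hT | hT⟩ := accepts_or_rejects hp Q
  · have h : ∃ i T, Accepts p T (Q.ancestor (i + 1)) := by
      by_contra! hcon
      exact hQ ⟨⟨T, hT⟩, hcon⟩
    obtain ⟨i, T', h⟩ := h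
    exact ⟨T' + i + 1, Or.inr ⟨i, by omega, h.mono (by omega)⟩⟩
  · exact ⟨T, Or.inl hT⟩

variable {p' : ℕ → ℕ}

theorem accepts_congr (h : ∀ i < 2 * T, p i = p' i) : Accepts p T Q ↔ Accepts p' T Q :=
  exists_congr fun t => and_congr_right fun ht => and_congr
    (avoids_congr (fun i hi => h i (by omega)) _ _) (forall₂_congr fun s hs => not_congr
      (meets_congr (fun i hi => h i (by omega)) _ _))

theorem rejects_congr (h : ∀ i < 2 * T, p i = p' i) : Rejects p T Q ↔ Rejects p' T Q :=
  exists_congr fun t => and_congr_right fun ht => and_congr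
    (meets_congr (fun i hi => h i (by omega)) _ _) (forall₂_congr fun s hs => not_congr
      (avoids_congr (fun i hi => h i (by omega)) _ _))

theorem selects_congr (h : ∀ i < 2 * T, p i = p' i) : Selects p T Q ↔ Selects p' T Q :=
  and_congr (accepts_congr h) (exists_congr fun _ => and_congr_right fun _ => and_congr
    (meets_congr h _ _) (forall₂_congr fun _ _ => rejects_congr h))

theorem discards_congr (h : ∀ i < 2 * T, p i = p' i) : Discards p T Q ↔ Discards p' T Q :=
  or_congr (rejects_congr h) (exists_congr fun _ => and_congr_right fun _ => accepts_congr h)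

end Decide

/-! ### Primitive recursiveness of the membership tests -/

section Primrec

variable {α : Type*} [Primcodable α] {L : α → List ℕ} {T : α → ℕ} {Q : α → DyadicCube n}

theorem primrecPred_far (hL : Primrec L) (hT : Primrec T) (hQ : Primrec Q) :
    PrimrecPred fun x => Far (fun i => (L x).getD i 0) (T x) (Q x) :=
  primrecPred_avoids hL hT (primrecReal_center hQ)
    ((PrimrecReal.natCast (Primrec.const _)).mul (primrecReal_side hQ))

theorem primrecPred_near (hL : Primrec L) (hT : Primrec T) (hQ : Primrec Q) :
    PrimrecPred fun x => Near (fun i => (L x).getD i 0) (T x) (Q x) :=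
  primrecPred_meets hL hT (primrecReal_center hQ)
    (((PrimrecReal.const (sqrtBound n + 1 / 4)).of_eq fun x => by push_cast; rfl).mul
      (primrecReal_side hQ))

theorem primrecPred_accepts (hL : Primrec L) (hT : Primrec T) (hQ : Primrec Q) :
    PrimrecPred fun x => Accepts (fun i => (L x).getD i 0) (T x) (Q x) :=
  primrecPred_exists_lt ((primrecPred_far (hL.comp Primrec.fst) Primrec.snd
    (hQ.comp Primrec.fst)).and (primrecPred_forall_lt (primrecPred_near
      (hL.comp (Primrec.fst.comp Primrec.fst)) Primrec.snd
      (hQ.comp (Primrec.fst.comp Primrec.fst))).not Primrec.snd)) hT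

theorem primrecPred_rejects (hL : Primrec L) (hT : Primrec T) (hQ : Primrec Q) :
    PrimrecPred fun x => Rejects (fun i => (L x).getD i 0) (T x) (Q x) :=
  primrecPred_exists_lt ((primrecPred_near (hL.comp Primrec.fst) Primrec.snd
    (hQ.comp Primrec.fst)).and (primrecPred_forall_lt (primrecPred_far
      (hL.comp (Primrec.fst.comp Primrec.fst)) Primrec.snd
      (hQ.comp (Primrec.fst.comp Primrec.fst))).not (Primrec.succ.comp Primrec.snd))) hT

theorem primrecPred_selects (hL : Primrec L) (hT : Primrec T) (hQ : Primrec Q) :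
    PrimrecPred fun x => Selects (fun i => (L x).getD i 0) (T x) (Q x) := by
  have hQ' := hQ.comp (Primrec.fst (β := ℕ))
  refine (primrecPred_accepts hL hT hQ).and (primrecPred_exists_lt (PrimrecPred.and ?_
    (primrecPred_forall_lt (primrecPred_rejects (hL.comp (Primrec.fst.comp Primrec.fst))
      (hT.comp (Primrec.fst.comp Primrec.fst)) (primrec_ancestor (Primrec.succ.comp Primrec.snd)
        (hQ.comp (Primrec.fst.comp Primrec.fst)))) Primrec.snd)) hT)
  refine primrecPred_meets (hL.comp Primrec.fst) (hT.comp Primrec.fst) (primrecReal_center hQ') ?_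
  exact ((PrimrecReal.natCast (primrec_two_pow Primrec.snd)).mul
    ((PrimrecReal.const (1 / 2)).mul (primrecReal_side hQ'))).of_eq fun z => by push_cast; rfl

theorem primrecPred_discards (hL : Primrec L) (hT : Primrec T) (hQ : Primrec Q) :
    PrimrecPred fun x => Discards (fun i => (L x).getD i 0) (T x) (Q x) :=
  (primrecPred_rejects hL hT hQ).or (primrecPred_exists_lt (primrecPred_accepts
    (hL.comp Primrec.fst) (hT.comp Primrec.fst) (primrec_ancestor (Primrec.succ.comp Primrec.snd)
      (hQ.comp Primrec.fst))) hT)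

end Primrec

/-- The test whether the tag `w.unpair.1` is the value at `c` of the characteristic function of the
Whitney family. -/
def DecidesCube (n : ℕ) (L : List ℕ) (c w : ℕ) : Prop :=
  2 * w.unpair.2 ≤ L.length ∧
    ((w.unpair.1 = 1 ∧ Selects (fun i => L.getD i 0) w.unpair.2 (DyadicCube.ofCode n c)) ∨
      (w.unpair.1 = 0 ∧ Discards (fun i => L.getD i 0) w.unpair.2 (DyadicCube.ofCode n c)))

theorem primrecPred_decidesCube (n : ℕ) :
    PrimrecPred fun z : List ℕ × ℕ × ℕ => DecidesCube n z.1 z.2.1 z.2.2 := by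
  have hw : Primrec fun z : List ℕ × ℕ × ℕ => z.2.2.unpair :=
    Primrec.unpair.comp (Primrec.snd.comp Primrec.snd)
  have hQ : Primrec fun z : List ℕ × ℕ × ℕ => DyadicCube.ofCode n z.2.1 :=
    primrec_ofCode.comp (Primrec.fst.comp Primrec.snd)
  have hT := Primrec.snd.comp hw
  have htag := Primrec.fst.comp hw
  exact (Primrec.nat_le.comp (Primrec.nat_double.comp hT)
    (Primrec.list_length.comp Primrec.fst)).and
    (((Primrec.eq.comp htag (Primrec.const 1)).and (primrecPred_selects Primrec.fst hT hQ)).or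
      ((Primrec.eq.comp htag (Primrec.const 0)).and (primrecPred_discards Primrec.fst hT hQ)))

theorem decidesCube_initialPart {p : ℕ → ℕ} {t c w : ℕ} :
    DecidesCube n (initialPart p t) c w ↔ 2 * w.unpair.2 ≤ t ∧
      ((w.unpair.1 = 1 ∧ Selects p w.unpair.2 (DyadicCube.ofCode n c)) ∨
        (w.unpair.1 = 0 ∧ Discards p w.unpair.2 (DyadicCube.ofCode n c))) := by
  rw [DecidesCube, length_initialPart]
  refine and_congr_right fun ht => ?_
  -- The length condition ensures that the default value 0 beyond the prefix is never consulted.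
  have h : ∀ i < 2 * w.unpair.2, (initialPart p t).getD i 0 = p i := fun i hi =>
    getD_initialPart p (by omega)
  rw [selects_congr h, discards_congr h]

theorem CUBE_dom (hn : 1 ≤ n) :
    (CUBE n).dom = {F : ClosedSet n | (F : Set (Space n)).Nonempty} := by
  ext F
  refine ⟨fun ⟨_, hW⟩ => hW.1, fun hF => ?_⟩
  obtain ⟨p, hp⟩ := (totalRep n).surj F
  exact ⟨_, whitneyFamily_mem_CUBE hn hF hp⟩

theorem CUBE_isComputable (hn : 1 ≤ n) : (CUBE n).IsComputable (totalRep n) (cubeSetRep n) := by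
  refine Problem.isComputable_of_search (out := fun _ _ w => w.unpair.1)
    (primrecPred_decidesCube n)
    (Primrec.fst.comp (Primrec.unpair.comp (Primrec.snd.comp Primrec.snd))) ?_
  intro p F hp hdom
  have hF : (F : Set (Space n)).Nonempty := by
    rwa [CUBE_dom hn] at hdom
  -- An entry is needed at every number c, code or not; reading c through the total function
  -- `ofCode` provides one.
  refine ⟨fun c => ?_, fun q hq => ⟨whitneyFamily n p, ?_, whitneyFamily_mem_CUBE hn hF hp⟩⟩
  · simp only [decidesCube_initialPart]
    by_cases hc : DyadicCube.ofCode n c ∈ whitneyFamily n p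
    · obtain ⟨T, hT⟩ := exists_selects hF hp hc
      refine ⟨Nat.pair 1 T, Filter.eventually_atTop.2 ⟨2 * T, fun t ht => ?_⟩⟩
      simpa using ⟨ht, hT⟩
    · obtain ⟨T, hT⟩ := exists_discards hp hc
      refine ⟨Nat.pair 0 T, Filter.eventually_atTop.2 ⟨2 * T, fun t ht => ?_⟩⟩
      simpa using ⟨ht, hT⟩
  · ext Q
    obtain ⟨t, w, h, hqw⟩ := hq Q.code
    obtain ⟨-, h⟩ := decidesCube_initialPart.1 h
    rw [DyadicCube.ofCode_code] at h
    simp only [Set.mem_ofPred_eq, hqw]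
    rcases h with ⟨h1, h⟩ | ⟨h1, h⟩
    · simpa [h1] using h.mem hn hp
    · simpa [h1] using h.notMem

/-! ### Cubes near a point -/

/-- The point z is obtained by clamping each coordinate of x to the cube. -/
theorem DyadicCube.exists_mem_dist_le {Q : DyadicCube n} {x : Space n} {δ : ℝ} (hδ : 0 ≤ δ)
    (h : ∀ j, |x j - Q.center j| ≤ Q.side / 2 + δ) : ∃ z ∈ Q.toSet, dist x z ≤ √n * δ := by
  have hs := Q.side_pos
  refine ⟨WithLp.toLp 2 fun j => Q.center j + max (-(Q.side / 2)) (min (Q.side / 2)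
    (x j - Q.center j)), DyadicCube.mem_toSet_iff_abs.2 fun j => ?_,
    dist_le_sqrt_mul hδ fun j => ?_⟩
  · rw [add_sub_cancel_left, abs_le]
    exact ⟨le_max_left _ _, max_le (by linarith) (min_le_left _ _)⟩
  · have h' := abs_le.1 (h j)
    rw [← sub_sub, abs_le]
    constructor
    · have : max (-(Q.side / 2)) (min (Q.side / 2) (x j - Q.center j)) ≤ x j - Q.center j + δ :=
        max_le (by linarith) ((min_le_right _ _).trans (by linarith))
      linarith
    · have : x j - Q.center j - δ ≤ max (-(Q.side / 2)) (min (Q.side / 2) (x j - Q.center j)) :=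
        le_max_of_le_right (le_min (by linarith) (by linarith))
      linarith

/-- The edge lengths of cubes of a Whitney family that are close to a common point are
comparable. -/
theorem side_lt_of_near {F : ClosedSet n} {W : Set (DyadicCube n)} (hW : W ∈ CUBE n F)
    {Q Q' : DyadicCube n} (hQ : Q ∈ W) (hQ' : Q' ∈ W) {x : Space n}
    (hx : ∀ j, |x j - Q.center j| ≤ 3 / 5 * Q.side)
    (hx' : ∀ j, |x j - Q'.center j| ≤ 3 / 5 * Q'.side) : Q.side < 16 * Q'.side := by
  obtain ⟨hF, -, -, hdist⟩ := hW
  have hs := Q.side_pos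
  have hs' := Q'.side_pos
  obtain ⟨z, hz, hxz⟩ := Q.exists_mem_dist_le (δ := Q.side / 10) (by linarith)
    fun j => (hx j).trans (by linarith)
  obtain ⟨z', hz', hxz'⟩ := Q'.exists_mem_dist_le (δ := Q'.side / 10) (by linarith)
    fun j => (hx' j).trans (by linarith)
  have h1 := (hdist Q hQ).1
  have h2 := (hdist Q' hQ').2
  rw [DyadicCube.diam_toSet] at h1 h2
  obtain ⟨u, hu, y, hy, huy⟩ := exists_dist_lt_of_setDist_lt ⟨_, hz'⟩ hF h2
  have h3 := setDist_le_dist hz hy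
  have h4 := DyadicCube.dist_le hz' hu
  have h5 : dist z y ≤ dist x z + dist x z' + dist z' u + dist u y := by
    linarith [dist_triangle_left z y x, dist_triangle x z' y, dist_triangle z' u y]
  -- With sides s and s': s/2 < s/10 + s'/10 + s' + 5s', whence s < 15.25 s'.
  have h6 : √(n : ℝ) * (2 / 5 * Q.side) < √(n : ℝ) * (61 / 10 * Q'.side) := by linarith
  have h7 := lt_of_mul_lt_mul_left h6 (Real.sqrt_nonneg _)
  linarith

/-- A cube next to the third ancestor of `Q`, of a level that exceeds the level of this ancestor
by `a`. -/
def candidate (Q : DyadicCube n) (a e : ℕ) : DyadicCube n :=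
  (Q.1 - 3 + a, fun j => (Q.ancestor 3).2 j * (2 ^ a : ℕ) +
    ((e / (2 ^ a + 2) ^ (j : ℕ) % (2 ^ a + 2) : ℕ) : ℤ) - (1 : ℕ))

def candidates (Q : DyadicCube n) : List (DyadicCube n) :=
  (List.range 7).flatMap fun a => (List.range ((2 ^ a + 2) ^ n)).map (candidate Q a)

theorem mem_candidates {Q Q' : DyadicCube n} : Q' ∈ candidates Q ↔
    ∃ a : ℕ, a < 7 ∧ Q'.1 = Q.1 - 3 + a ∧ ∀ j, (Q.ancestor 3).2 j * 2 ^ a - 1 ≤ Q'.2 j ∧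
      Q'.2 j ≤ ((Q.ancestor 3).2 j + 1) * 2 ^ a := by
  simp only [candidates, List.mem_flatMap, List.mem_range, List.mem_map]
  refine exists_congr fun a => and_congr_right fun _ => ⟨?_, ?_⟩
  · rintro ⟨e, -, rfl⟩
    refine ⟨rfl, fun j => ?_⟩
    have h : e / (2 ^ a + 2) ^ (j : ℕ) % (2 ^ a + 2) < 2 ^ a + 2 := Nat.mod_lt _ (by positivity)
    simp only [candidate]
    generalize e / (2 ^ a + 2) ^ (j : ℕ) % (2 ^ a + 2) = d at h ⊢
    have h' : (d : ℤ) < 2 ^ a + 2 := by exact_mod_cast h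
    push_cast
    constructor <;> linarith
  · rintro ⟨h1, h2⟩
    have hd : ∀ j, 0 ≤ Q'.2 j - ((Q.ancestor 3).2 j * 2 ^ a - 1) := fun j => by linarith [h2 j]
    obtain ⟨e, he, hed⟩ := exists_digits (b := 2 ^ a + 2)
      (d := fun j => (Q'.2 j - ((Q.ancestor 3).2 j * 2 ^ a - 1)).toNat) fun j => by
        zify
        rw [Int.toNat_of_nonneg (hd j)]
        linarith [h2 j]
    refine ⟨e, he, Prod.ext h1.symm (funext fun j => ?_)⟩
    simp only [candidate]
    rw [hed j, Int.toNat_of_nonneg (hd j)]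
    push_cast
    ring

theorem mem_candidates_of_near {F : ClosedSet n} {W : Set (DyadicCube n)}
    (hW : W ∈ CUBE n F) {Q Q' : DyadicCube n} (hQ : Q ∈ W) (hQ' : Q' ∈ W) {x : Space n}
    (hx : ∀ j, |x j - Q.center j| ≤ 9 / 16 * Q.side)
    (hx' : ∀ j, |x j - Q'.center j| ≤ 3 / 5 * Q'.side) : Q' ∈ candidates Q := by
  have hs := Q.side_pos
  have hs' := Q'.side_pos
  have hx1 : ∀ j, |x j - Q.center j| ≤ 3 / 5 * Q.side := fun j => (hx j).trans (by linarith)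
  have key : ∀ {k k' : ℤ}, (2 : ℝ) ^ (-k) < 16 * 2 ^ (-k') → k' < k + 4 := by
    intro k k' h
    rw [show (16 : ℝ) = 2 ^ (4 : ℤ) by norm_num, ← zpow_add₀ two_ne_zero,
      zpow_lt_zpow_iff_right₀ one_lt_two] at h
    omega
  have h1 : Q'.1 < Q.1 + 4 := key (side_lt_of_near hW hQ hQ' hx1 hx')
  have h2 : Q.1 < Q'.1 + 4 := key (side_lt_of_near hW hQ' hQ hx' hx1)
  obtain ⟨a, ha⟩ := Int.eq_ofNat_of_zero_le (show 0 ≤ Q'.1 - (Q.1 - 3) by omega)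
  have ha7 : a < 7 := by omega
  have hside : (2 : ℝ) ^ 3 * Q.side = 2 ^ a * Q'.side := by
    have e1 : (2 : ℝ) ^ 3 * Q.side = 2 ^ (3 - Q.1) := by
      rw [DyadicCube.side, sub_eq_add_neg, zpow_add₀ two_ne_zero]
      norm_num
    have e2 : (2 : ℝ) ^ a * Q'.side = 2 ^ ((a : ℤ) - Q'.1) := by
      rw [DyadicCube.side, sub_eq_add_neg, zpow_add₀ two_ne_zero, zpow_natCast]
    rw [e1, e2]
    congr 1
    omega
  have ha64 : (2 : ℝ) ^ a ≤ 64 :=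
    (pow_le_pow_right₀ one_le_two (show a ≤ 6 by omega)).trans (by norm_num)
  refine mem_candidates.2 ⟨a, ha7, by omega, fun j => ?_⟩
  obtain ⟨b1, b2⟩ := DyadicCube.ancestor_bounds 3 Q j
  set m := (Q.ancestor 3).2 j with hm
  have hxj := abs_le.1 (hx j)
  have hxj' := abs_le.1 (hx' j)
  rw [DyadicCube.center_apply] at hxj hxj'
  have b1' : (m : ℝ) * (2 ^ a * Q'.side) ≤ Q.2 j * Q.side := by
    rw [← hside, ← mul_assoc]
    exact mul_le_mul_of_nonneg_right b1 hs.le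
  have b2' : (Q.2 j + 1) * Q.side ≤ ((m : ℝ) + 1) * (2 ^ a * Q'.side) := by
    rw [← hside, ← mul_assoc]
    exact mul_le_mul_of_nonneg_right b2 hs.le
  have b3 : Q.side ≤ 8 * Q'.side := by
    have := mul_le_mul_of_nonneg_right ha64 hs'.le
    linarith
  -- The point x leaves the third ancestor by at most `Q.side / 16`, which is at most `Q'.side / 2`,
  -- and leaves `Q'` by at most `Q'.side / 10`. So the index of `Q'` is off by less than 2 below and
  -- less than 1 above, and integrality finishes.
  have c1 : ((m : ℝ) * 2 ^ a - 2) * Q'.side < Q'.2 j * Q'.side := by nlinarith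
  have c2 : (Q'.2 j : ℝ) * Q'.side < (((m : ℝ) + 1) * 2 ^ a + 1) * Q'.side := by nlinarith
  have d1 : m * 2 ^ a - 2 < Q'.2 j := by exact_mod_cast lt_of_mul_lt_mul_right c1 hs'.le
  have d2 : Q'.2 j < (m + 1) * 2 ^ a + 1 := by exact_mod_cast lt_of_mul_lt_mul_right c2 hs'.le
  constructor
  · exact Int.le_of_sub_one_lt (by linarith)
  · exact Int.lt_add_one_iff.1 d2

/-- The members of a family among the candidates are determined by the dyadic subcubes of level
`Q.1 + 3` at their lower corners. -/
theorem card_le_of_subset_candidates {W : Set (DyadicCube n)}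
    (hW : ∀ Q ∈ W, ∀ Q' ∈ W, Q ≠ Q' → interior Q.toSet ∩ interior Q'.toSet = ∅)
    (Q : DyadicCube n) {G : Finset (DyadicCube n)} (hGW : (G : Set (DyadicCube n)) ⊆ W)
    (hG : ∀ Q' ∈ G, Q' ∈ candidates Q) : G.card ≤ 129 ^ n := by
  classical
  -- Level `Q.1 + 3` is the finest among the candidates, so each contains a subcube of this level at
  -- its lower corner. Disjoint interiors force different corners, which range over 129 values per
  -- coordinate.
  let corner : DyadicCube n → Fin n → ℤ := fun Q' j => Q'.2 j * 2 ^ (Q.1 + 3 - Q'.1).toNat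
  have hanc : ∀ Q' ∈ G,
      Q' = DyadicCube.ancestor (Q.1 + 3 - Q'.1).toNat (Q.1 + 3, corner Q') := by
    intro Q' hQ'
    obtain ⟨a, ha, h1, -⟩ := mem_candidates.1 (hG Q' hQ')
    refine Prod.ext ?_ (funext fun j => ?_)
    · simp only [DyadicCube.ancestor]
      omega
    · simp only [DyadicCube.ancestor, corner]
      push_cast
      rw [Int.mul_ediv_cancel _ (by positivity)]
  have hcenter : ∀ Q' ∈ G, DyadicCube.center (Q.1 + 3, corner Q') ∈ interior Q'.toSet := by
    intro Q' hQ'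
    have h := interior_mono (DyadicCube.toSet_subset_ancestor (Q.1 + 3 - Q'.1).toNat
      (Q.1 + 3, corner Q')) (DyadicCube.center_mem_interior _)
    rwa [← hanc Q' hQ'] at h
  have hinj : Set.InjOn corner G := by
    intro Q₁ h₁ Q₂ h₂ heq
    by_contra hne
    refine Set.notMem_empty (DyadicCube.center (Q.1 + 3, corner Q₁)) ?_
    rw [← hW Q₁ (hGW h₁) Q₂ (hGW h₂) hne]
    refine ⟨hcenter Q₁ h₁, ?_⟩
    rw [heq]
    exact hcenter Q₂ h₂
  have hmaps : Set.MapsTo corner G (Fintype.piFinset fun j => Finset.Icc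
      (64 * (Q.ancestor 3).2 j - 64) (64 * (Q.ancestor 3).2 j + 64) : Finset (Fin n → ℤ)) := by
    intro Q' hQ'
    obtain ⟨a, ha, h1, h2⟩ := mem_candidates.1 (hG Q' hQ')
    rw [Finset.mem_coe, Fintype.mem_piFinset]
    intro j
    have ht : (Q.1 + 3 - Q'.1).toNat = 6 - a := by omega
    simp only [corner, Finset.mem_Icc, ht]
    obtain ⟨h3, h4⟩ := h2 j
    have h5 : (2 : ℤ) ^ a * 2 ^ (6 - a) = 64 := by
      rw [← pow_add, show a + (6 - a) = 6 by omega]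
      norm_num
    have h6 : (0 : ℤ) < 2 ^ (6 - a) := by positivity
    have h7 : (2 : ℤ) ^ (6 - a) ≤ 64 :=
      (pow_le_pow_right₀ one_le_two (show 6 - a ≤ 6 by omega)).trans (by norm_num)
    have h8 := mul_le_mul_of_nonneg_right h3 h6.le
    have h9 := mul_le_mul_of_nonneg_right h4 h6.le
    rw [sub_mul, mul_assoc, h5] at h8
    rw [mul_assoc, h5] at h9
    constructor <;> linarith
  refine (Finset.card_le_card_of_injOn corner hmaps hinj).trans_eq ?_
  rw [Fintype.card_piFinset]
  simp only [Int.card_Icc]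
  rw [Finset.prod_congr rfl fun j _ => show (64 * (Q.ancestor 3).2 j + 64 + 1 -
    (64 * (Q.ancestor 3).2 j - 64)).toNat = 129 by omega]
  simp

theorem filter_candidates_mem_nearCubes (hn : 1 ≤ n) {ε : ℚ} (hε : 0 < ε) (hε' : ε < 1 / 5)
    {F : ClosedSet n} {W : Set (DyadicCube n)} (hW : W ∈ CUBE n F) {x : Space n} (hx : x ∉ F)
    {Q : DyadicCube n} (hQ : Q ∈ W) (hxQ : ∀ j, |x j - Q.center j| ≤ 9 / 16 * Q.side)
    {G : Finset (DyadicCube n)} (hG : ∀ Q', Q' ∈ G ↔ Q' ∈ candidates Q ∧ Q' ∈ W) :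
    G ∈ nearCubes n ε (F, W, x) := by
  have hGW : (G : Set (DyadicCube n)) ⊆ W := fun Q' h => ((hG Q').1 h).2
  refine ⟨hW, hx, hGW, ?_, ?_⟩
  · rintro Q' ⟨hQ', hxQ'⟩
    refine (hG Q').2 ⟨mem_candidates_of_near hW hQ hQ' hxQ fun j => ?_, hQ'⟩
    have h1 := DyadicCube.abs_sub_center_le_of_mem_enlarged hε hxQ' j
    have h2 : (ε : ℝ) < 1 / 5 := by
      have := (Rat.cast_lt (K := ℝ)).2 hε'
      push_cast at this
      exact this
    -- (1 + ε)/2 < 3/5 since ε < 1/5.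
    nlinarith [Q'.side_pos]
  · refine (card_le_of_subset_candidates hW.2.2.1 Q hGW fun Q' h => ((hG Q').1 h).1).trans
      (Nat.pow_le_pow_left ?_ n)
    have h1 := one_le_sqrt hn
    have h2 := Nat.le_ceil (197 * √(n : ℝ))
    have h3 : ((129 : ℕ) : ℝ) ≤ ⌈197 * √(n : ℝ)⌉₊ := by
      push_cast
      linarith
    exact_mod_cast h3

/-! #### Searching for a cube at a point -/

/-- The `i`-th approximation of the point in the name `p` of a triple is seen to be close to the
cube `Q`. -/
def Locates (p : ℕ → ℕ) (Q : DyadicCube n) (i : ℕ) : Prop :=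
  (2 : ℝ) ^ (-(i : ℤ)) ≤ 1 / 32 * Q.side ∧ ∀ j,
    ratPoint n (p (4 * i + 3)) j ≤ Q.center j + 17 / 32 * Q.side ∧
      Q.center j ≤ ratPoint n (p (4 * i + 3)) j + 17 / 32 * Q.side

theorem two_zpow_neg_natCast (i : ℕ) : (2 : ℝ) ^ (-(i : ℤ)) = 2⁻¹ ^ i := by
  rw [zpow_neg, zpow_natCast, inv_pow]

/-- The tolerance 17/32 and the approximation error 1/32 add up to 9/16. -/
theorem Locates.abs_sub_le {p : ℕ → ℕ} {Q : DyadicCube n} {i : ℕ} (h : Locates p Q i)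
    {x : Space n} (hx : (cauchyRep n).IsName (fun i => p (4 * i + 3)) x) (j : Fin n) :
    |x j - Q.center j| ≤ 9 / 16 * Q.side := by
  obtain ⟨h1, h2⟩ := h
  have h3 := (abs_sub_apply_le_dist _ x j).trans (hx.2 i).le
  rw [← two_zpow_neg_natCast, abs_le] at h3
  have h4 := h2 j
  rw [abs_le]
  constructor <;> linarith

/-- Points of Q deviate by at most 16/32 of the side from the centre, so an approximation with error
at most 1/32 passes. -/
theorem exists_locates {p : ℕ → ℕ} {Q : DyadicCube n} {x : Space n}
    (hx : (cauchyRep n).IsName (fun i => p (4 * i + 3)) x) (hxQ : x ∈ Q.toSet) :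
    ∃ i, Locates p Q i := by
  have hs : 0 < 1 / 32 * Q.side := mul_pos (by norm_num) Q.side_pos
  obtain ⟨i, hi⟩ := exists_pow_lt_of_lt_one hs (show (2⁻¹ : ℝ) < 1 by norm_num)
  refine ⟨i, by rw [two_zpow_neg_natCast]; exact hi.le, fun j => ?_⟩
  have h1 := abs_le.1 ((abs_sub_apply_le_dist _ x j).trans (hx.2 i).le)
  have h2 := abs_le.1 (DyadicCube.mem_toSet_iff_abs.1 hxQ j)
  constructor <;> linarith

/-- The test whether `w.unpair.1` is the code of a member of the family and `w.unpair.2` the index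
of an approximation of the point that is close to it, where membership of the candidates can be
read off from `L`. -/
def FindsCube (n : ℕ) (L : List ℕ) (w : ℕ) : Prop :=
  4 * w.unpair.2 + 3 < L.length ∧
    (∀ Q ∈ candidates (DyadicCube.ofCode n w.unpair.1), 4 * Q.code + 1 < L.length) ∧
    4 * (DyadicCube.ofCode n w.unpair.1).code + 1 < L.length ∧
    L.getD (4 * (DyadicCube.ofCode n w.unpair.1).code + 1) 0 = 1 ∧
    Locates (fun i => L.getD i 0) (DyadicCube.ofCode n w.unpair.1) w.unpair.2

def foundCubes (n : ℕ) (L : List ℕ) (w : ℕ) : List (DyadicCube n) :=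
  (candidates (DyadicCube.ofCode n w.unpair.1)).filter fun Q => L.getD (4 * Q.code + 1) 0 = 1

/-! ### Primitive recursiveness of the search for nearby cubes -/

section Primrec

variable {α : Type*} [Primcodable α] {L : α → List ℕ} {Q : α → DyadicCube n} {i : α → ℕ}

theorem primrec_candidates : Primrec (candidates : DyadicCube n → List (DyadicCube n)) := by
  have hb : Primrec fun a : ℕ => 2 ^ a + 2 :=
    Primrec.nat_add.comp (primrec_two_pow Primrec.id) (Primrec.const 2)
  refine Primrec.list_flatMap (Primrec.const _) (Primrec.list_map (Primrec.list_range.comp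
    (primrec_nat_pow (hb.comp Primrec.snd) (Primrec.const n))) ?_)
  have hQ : Primrec fun z : (DyadicCube n × ℕ) × ℕ => z.1.1 := Primrec.fst.comp Primrec.fst
  have ha : Primrec fun z : (DyadicCube n × ℕ) × ℕ => z.1.2 := Primrec.snd.comp Primrec.fst
  refine Primrec.pair (primrec_int_add (primrec_int_sub (Primrec.fst.comp hQ)
    (Primrec.const 3)) (primrec_natCast_int ha)) (primrec_pi_iff.2 fun j => ?_)
  refine primrec_int_sub (primrec_int_add (primrec_int_mul_natCast (primrec_pi_iff.1
    (Primrec.snd.comp (primrec_ancestor (Primrec.const 3) hQ)) j) (primrec_two_pow ha))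
    (primrec_natCast_int ?_)) (primrec_natCast_int (Primrec.const 1))
  exact Primrec.nat_mod.comp (Primrec.nat_div.comp Primrec.snd (primrec_nat_pow (hb.comp ha)
    (Primrec.const (j : ℕ)))) (hb.comp ha)

theorem primrec_charIndex : Primrec fun Q : DyadicCube n => 4 * Q.code + 1 :=
  Primrec.succ.comp (Primrec.nat_mul.comp (Primrec.const 4) primrec_code)

theorem primrecPred_locates (hL : Primrec L) (hQ : Primrec Q) (hi : Primrec i) :
    PrimrecPred fun x => Locates (fun i => (L x).getD i 0) (Q x) (i x) := by
  have hy : ∀ j, PrimrecReal fun x => ratPoint n ((L x).getD (4 * i x + 3) 0) j :=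
    primrecReal_ratPoint ((Primrec.list_getD 0).comp hL (Primrec.nat_add.comp
      (Primrec.nat_mul.comp (Primrec.const 4) hi) (Primrec.const 3)))
  have hq : ∀ q : ℚ, PrimrecReal fun x => q * (Q x).side := fun q =>
    (PrimrecReal.const q).mul (primrecReal_side hQ)
  have hs : PrimrecReal fun x => 17 / 32 * (Q x).side :=
    (hq (17 / 32)).of_eq fun x => by push_cast; rfl
  exact ((PrimrecReal.two_zpow_neg (primrec_natCast_int hi)).le
    ((hq (1 / 32)).of_eq fun x => by push_cast; rfl)).and (primrecPred_forall_fin fun j =>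
      ((hy j).le ((primrecReal_center hQ j).add hs)).and
        ((primrecReal_center hQ j).le ((hy j).add hs)))

theorem primrecPred_findsCube (n : ℕ) :
    PrimrecPred fun z : List ℕ × ℕ × ℕ => FindsCube n z.1 z.2.2 := by
  have hw : Primrec fun z : List ℕ × ℕ × ℕ => z.2.2.unpair :=
    Primrec.unpair.comp (Primrec.snd.comp Primrec.snd)
  have hi := Primrec.snd.comp hw
  have hQ : Primrec fun z : List ℕ × ℕ × ℕ => DyadicCube.ofCode n z.2.2.unpair.1 :=
    primrec_ofCode.comp (Primrec.fst.comp hw)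
  have hl : Primrec fun z : List ℕ × ℕ × ℕ => z.1.length := Primrec.list_length.comp Primrec.fst
  have hr : PrimrecRel fun (Q : DyadicCube n) (m : ℕ) => 4 * Q.code + 1 < m :=
    Primrec.nat_lt.comp (primrec_charIndex.comp Primrec.fst) Primrec.snd
  have h0 := primrec_charIndex.comp hQ
  exact (Primrec.nat_lt.comp (Primrec.nat_add.comp (Primrec.nat_mul.comp (Primrec.const 4) hi)
    (Primrec.const 3)) hl).and ((hr.forall_mem_list.comp (primrec_candidates.comp hQ) hl).and
    ((Primrec.nat_lt.comp h0 hl).and ((Primrec.eq.comp ((Primrec.list_getD 0).comp Primrec.fst h0)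
      (Primrec.const 1)).and (primrecPred_locates Primrec.fst hQ hi))))

theorem primrec_foundCubes (n : ℕ) :
    Primrec fun z : List ℕ × ℕ × ℕ => foundCubes n z.1 z.2.2 := by
  have hr : PrimrecRel fun (Q : DyadicCube n) (L : List ℕ) => L.getD (4 * Q.code + 1) 0 = 1 :=
    Primrec.eq.comp ((Primrec.list_getD 0).comp Primrec.snd
      (primrec_charIndex.comp Primrec.fst)) (Primrec.const 1)
  exact hr.listFilter.comp (primrec_candidates.comp (primrec_ofCode.comp (Primrec.fst.comp
    (Primrec.unpair.comp (Primrec.snd.comp Primrec.snd))))) Primrec.fst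

end Primrec

theorem locates_initialPart {p : ℕ → ℕ} {t i : ℕ} (h : 4 * i + 3 < t) (Q : DyadicCube n) :
    Locates (fun i => (initialPart p t).getD i 0) Q i ↔ Locates p Q i := by
  simp only [Locates, getD_initialPart p h]

theorem nearCubes_dom (hn : 1 ≤ n) {ε : ℚ} (hε : 0 < ε) (hε' : ε < 1 / 5) :
    (nearCubes n ε).dom = {z | z.2.1 ∈ CUBE n z.1 ∧ z.2.2 ∉ z.1} := by
  classical
  ext ⟨F, W, x⟩
  refine ⟨fun ⟨_, hG⟩ => ⟨hG.1, hG.2.1⟩, ?_⟩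
  rintro ⟨hW, hx⟩
  have hx' : x ∈ ⋃ Q ∈ W, DyadicCube.toSet Q := by rw [hW.2.1]; exact hx
  simp only [Set.mem_iUnion, exists_prop] at hx'
  obtain ⟨Q, hQ, hxQ⟩ := hx'
  refine ⟨((candidates Q).filter (· ∈ W)).toFinset, filter_candidates_mem_nearCubes hn hε hε' hW hx
    hQ (fun j => (DyadicCube.mem_toSet_iff_abs.1 hxQ j).trans ?_) fun Q' => by simp⟩
  linarith [Q.side_pos]

theorem nearCubes_isComputable (hn : 1 ≤ n) {ε : ℚ} (hε : 0 < ε) (hε' : ε < 1 / 5) :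
    (nearCubes n ε).IsComputable
      ((totalRep n).prod ((cubeSetRep n).prod (cauchyRep n))) (finCubesRep n) := by
  classical
  refine Problem.isComputable_of_search (R := fun L _ w => FindsCube n L w)
    (out := fun L _ w => Encodable.encode ((foundCubes n L w).map DyadicCube.code))
    (primrecPred_findsCube n) (Primrec.encode.comp (Primrec.list_map (primrec_foundCubes n)
      (primrec_code.comp Primrec.snd))) ?_
  rintro p ⟨F, W, x⟩ ⟨-, hWname, hxname⟩ hdom
  rw [nearCubes_dom hn hε hε'] at hdom
  obtain ⟨hW, hx⟩ := hdom
  dsimp only at hW hx hWname hxname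
  -- In the name of the triple, F occupies the even positions, W the positions 4i + 1 and x the
  -- positions 4i + 3.
  have hWp : ∀ Q, Q ∈ W ↔ p (4 * Q.code + 1) = 1 := fun Q => by
    rw [show W = _ from hWname, Set.mem_ofPred_eq, left, right,
      show 2 * (2 * Q.code) + 1 = 4 * Q.code + 1 by ring]
  have hxp : (cauchyRep n).IsName (fun i => p (4 * i + 3)) x := by
    convert hxname using 2 with i
    rw [right, right, show 2 * (2 * i + 1) + 1 = 4 * i + 3 by ring]
  refine ⟨fun _ => ?_, fun q hq => ?_⟩
  · have hx' : x ∈ ⋃ Q ∈ W, DyadicCube.toSet Q := by rw [hW.2.1]; exact hx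
    simp only [Set.mem_iUnion, exists_prop] at hx'
    obtain ⟨Q, hQ, hxQ⟩ := hx'
    obtain ⟨i, hi⟩ := exists_locates hxp hxQ
    refine ⟨Nat.pair Q.code i, Filter.eventually_atTop.2
      -- The sum dominates each position at which the membership of a candidate is read.
      ⟨4 * i + 4 + (4 * Q.code + 2) + (((candidates Q).map fun Q' => 4 * Q'.code + 2).sum),
        fun t ht => ?_⟩⟩
    have hQt : 4 * Q.code + 1 < t := by omega
    simp only [FindsCube, Nat.unpair_pair, DyadicCube.ofCode_code, length_initialPart]
    refine ⟨by omega, fun Q' hQ' => ?_, hQt, ?_, (locates_initialPart (by omega) Q).2 hi⟩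
    · have := List.single_le_sum (l := (candidates Q).map fun Q' => 4 * Q'.code + 2)
        (fun _ _ => Nat.zero_le _) _ (List.mem_map_of_mem hQ')
      omega
    · rw [getD_initialPart p hQt]
      exact (hWp Q).1 hQ
  -- Only entry 0 carries the result. Any guess that passes yields a correct set, whichever cube
  -- near x was found.
  · obtain ⟨t, w, hw, hq0⟩ := hq 0
    obtain ⟨h1, h2, h3, h4, h5⟩ := hw
    rw [length_initialPart] at h1 h3
    rw [getD_initialPart p h3] at h4
    refine ⟨(foundCubes n (initialPart p t) w).toFinset, ⟨_, hq0, fun Q => by simp⟩,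
      filter_candidates_mem_nearCubes hn hε hε' hW hx ((hWp _).2 h4)
        (((locates_initialPart h1 _).1 h5).abs_sub_le hxp) fun Q => ?_⟩
    rw [List.mem_toFinset, foundCubes, List.mem_filter, decide_eq_true_iff]
    refine and_congr_right fun hQ => ?_
    have := h2 Q hQ
    rw [length_initialPart] at this
    rw [getD_initialPart p this, hWp]

end Whitney

end

theorem mainTheorem6 (n : ℕ) (hn : 1 ≤ n) (ε : ℚ) (hε : 0 < ε) (hε' : ε < 1 / 5) :
    ((Whitney.CUBE n).dom = {F : Whitney.ClosedSet n | (F : Set (Whitney.Space n)).Nonempty} ∧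
      (Whitney.CUBE n).IsComputable (Whitney.totalRep n) (Whitney.cubeSetRep n)) ∧
    ((Whitney.nearCubes n ε).dom = {z | z.2.1 ∈ Whitney.CUBE n z.1 ∧ z.2.2 ∉ z.1} ∧
      (Whitney.nearCubes n ε).IsComputable
        ((Whitney.totalRep n).prod ((Whitney.cubeSetRep n).prod (Whitney.cauchyRep n)))
        (Whitney.finCubesRep n)) := by
  exact ⟨⟨Whitney.CUBE_dom hn, Whitney.CUBE_isComputable hn⟩,
    Whitney.nearCubes_dom hn hε hε', Whitney.nearCubes_isComputable hn hε hε'⟩
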